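/- Let $N$ be an infinitely generated free nilpotent group of nilpotency class $c\ge 2$. A \emph{basis} of a free nilpotent group means a free generating set in the variety of nilpotent groups of its class. Let $\operatorname{Inn}N$ be the group of conjugations $\tau_a(z)=aza^{-1}$ ($a\in N$), which is free nilpotent of class $c-1$; a \emph{basis set of conjugations} is a basis $X$ of $\operatorname{Inn}N$. The group $\operatorname{Aut}N$ acts on $\operatorname{Inn} N$ by conjugation, $\tau\mapsto\rho\tau\rho^{-1}$, and $\operatorname{Sym}X$ denotes the group of all $\rho\in\operatorname{Aut}N$ with $\rho X\rho^{-1}=X$. Let $\pi^*\in\operatorname{Aut}N$ be such that, for some basis $\mathcal X$ of $N$, $\pi^*(\mathcal X)=\mathcal X$, there is exactly one element $x\in\mathcal X$ with $\pi^*(x)=x$, every orbit of $\pi^*$ on $\mathcal X\setminus\{x\}$ is infinite, and there are infinitely many such orbits. Then an automorphism $\pi\in\operatorname{Aut}N$ is conjugate to $\pi^*$ in $\operatorname{Aut}N$ if and only if there is a basis set $X$ of conjugations such that both of the following hold (for the action by conjugation). (a) $\pi\in\operatorname{Sym}X$, some $\tau'\in X$ is fixed by $\pi$, and $\pi$ acts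 on $X\setminus\{\tau'\}$ as a permutation with no fixed points and with infinitely many infinite orbits. (b) There is a linear order $<$ on $X$ that is invariant under $\pi$ and such that for every $n\ge 2$ there is a $\rho_n\in\operatorname{Sym}X$ which also preserves $<$ and satisfies $\pi=\rho_n^n$ in $\operatorname{Aut}N$. -/

import Mathlib

/-- `X` is a basis of the subgroup `H` of `G`, where `H` is regarded as a free nilpotent group of
class `c`: the homomorphism from the free group on `X` that extends the inclusion of `X` has
image `H`, and its kernel is `γ_{c+1}` of that free group. (Mathlib numbers the lower central
series from `0`, so that `(⊤ : Subgroup F).lowerCentralSeries c` is `γ_{c+1}(F)`.) -/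
def IsNilpotentBasis {G : Type*} [Group G] (c : ℕ) (H : Subgroup G) (X : Set G) : Prop :=
  (FreeGroup.lift (Subtype.val : X → G)).range = H ∧
    (FreeGroup.lift (Subtype.val : X → G)).ker = (⊤ : Subgroup (FreeGroup X)).lowerCentralSeries c

/-- `N` is a free nilpotent group of class `c`. -/
def IsFreeNilpotent (c : ℕ) (N : Type*) [Group N] : Prop :=
  ∃ B : Set N, IsNilpotentBasis c ⊤ B

/-- The subgroup `Inn N` of `Aut N`; its elements are the maps `z ↦ a * z * a⁻¹`. -/
def innerAutomorphisms (N : Type*) [Group N] : Subgroup (MulAut N) :=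
  (MulAut.conj : N →* MulAut N).range

/-- The orbit `{f ^ k (z) : k ∈ ℤ}`. -/
def orbitOf {G : Type*} [Group G] (f : MulAut G) (z : G) : Set G :=
  Set.range fun k : ℤ => (f ^ k) z

/-- `f` is permutational relative to a basis `X` of `N`, with exactly one fixed point in `X`; all
other orbits of `f` on `X` are infinite, and there are infinitely many of them. -/
def IsPiStar {N : Type*} [Group N] (c : ℕ) (f : MulAut N) : Prop :=
  ∃ X : Set N, IsNilpotentBasis c ⊤ X ∧ f '' X = X ∧
    ∃ x ∈ X, f x = x ∧ (∀ y ∈ X \ {x}, (orbitOf f y).Infinite) ∧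
      (orbitOf f '' (X \ {x})).Infinite

/-- The automorphisms of `N` that act on the set `X ⊆ Aut N`, by conjugation `τ ↦ ρ * τ * ρ⁻¹`,
as permutations. -/
def permutational {N : Type*} [Group N] (X : Set (MulAut N)) : Set (MulAut N) :=
  {ρ | MulAut.conj ρ '' X = X}

/-- In the conjugation action, `π` permutes `X` and fixes some `τ' ∈ X`; on `X \ {τ'}` it has no
fixed points and infinitely many infinite orbits (finite orbits are not excluded). -/
def ActsWithOneFixedPoint {N : Type*} [Group N] (X : Set (MulAut N)) (π : MulAut N) : Prop :=
  π ∈ permutational X ∧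
    ∃ τ' ∈ X, MulAut.conj π τ' = τ' ∧ (∀ τ ∈ X \ {τ'}, MulAut.conj π τ ≠ τ) ∧
      {O : Set (MulAut N) |
        O.Infinite ∧ ∃ τ ∈ X \ {τ'}, O = orbitOf (MulAut.conj π) τ}.Infinite

/-- The conjugation action of `ρ` preserves the given linear order on `X`. -/
def PreservesOrder {N : Type*} [Group N] (X : Set (MulAut N)) [LinearOrder X]
    (ρ : MulAut N) : Prop :=
  ∀ σ τ σ' τ' : X, (σ' : MulAut N) = MulAut.conj ρ σ → (τ' : MulAut N) = MulAut.conj ρ τ →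
    σ < τ → σ' < τ'

/-! For the direct implication, index a basis of $N$ by a fixed point together with $I\times\mathbb
Q$, so that $\pi$ is translation by $1$ on the rational coordinate. Translation by $1/m$ is an
$m$-th root, and all translations preserve the lexicographic order with the fixed point at the
bottom (`exists_conjugation_basis_of_isConj`).

For the converse, an order-preserving permutation has no nontrivial finite orbits, so the action of
$\pi$ on $X$ has the orbit type of $\pi^*$. Preimages of $X$ in $N$ form a basis
(`IsNilpotentFamily.of_conj`). On an infinite orbit they can be chosen compatibly with $\pi$ by
transporting one of them. The only obstruction is to find a preimage of $\tau'$ that is fixed by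
$\pi$; given one, $\pi$ permutes a basis of $N$ as $\pi^*$ does (`isConj_of_exists_lift`).

This obstruction is a cohomology class. If $x$ lifts $\tau'$, then $\pi(x)=xz$ with $z$ in the
center, which is the last nontrivial term of the lower central series. By the Magnus–Witt theorem
(`mem_lowerCentralSeries_of_leadingTerm`) that term is the lattice of integral Lie polynomials of
degree $c$, on which $\pi$ acts by permuting letters. A fixed lift exists exactly when the
polynomial $u$ of $z$ is a coboundary $\pi v-v$ with $v$ in the lattice.

A root $\rho$ of $\pi$ commutes with $\pi$, which makes $\rho u-u$ a coboundary; so the sums of $u$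
over $\pi$-orbits of words are constant along $\rho$. A nonzero sum would force $u$ to meet $n$
distinct $\pi$-orbits for every $n$, which a finite support forbids (`finsum_orbit_eq_zero`). Once
all orbit sums vanish, moving multihomogeneous components along orbits of multidegrees writes $u$ as
a coboundary inside the lattice (`exists_eq_coboundary`). These orbits are free because $c\ge2$:
every multidegree that occurs involves a letter other than the fixed one. -/

open scoped commutatorElement
open scoped PowerSeries

universe u

/-! ### Elimination of a letter in a free algebra -/

/-- The derivation of a free algebra that sends each letter `y` to the letter `s y`. -/
noncomputable def shiftDerivation (R : Type*) [CommRing R] {Y : Type*} (s : Y → Y) :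
    FreeAlgebra R Y →ₗ[R] FreeAlgebra R Y :=
  ((TrivSqZeroExt.sndHom (FreeAlgebra R Y) (FreeAlgebra R Y)).restrictScalars R).comp
    (FreeAlgebra.lift R fun y => (TrivSqZeroExt.inl (FreeAlgebra.ι R y) +
      TrivSqZeroExt.inr (FreeAlgebra.ι R (s y)) :
        TrivSqZeroExt (FreeAlgebra R Y) (FreeAlgebra R Y))).toLinearMap

theorem shiftDerivation_ι (R : Type*) [CommRing R] {Y : Type*} (s : Y → Y) (y : Y) :
    shiftDerivation R s (FreeAlgebra.ι R y) = FreeAlgebra.ι R (s y) := by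
  simp [shiftDerivation]

theorem shiftDerivation_mul (R : Type*) [CommRing R] {Y : Type*} (s : Y → Y)
    (p q : FreeAlgebra R Y) :
    shiftDerivation R s (p * q) = p * shiftDerivation R s q + shiftDerivation R s p * q := by
  have h : ((TrivSqZeroExt.fstHom R (FreeAlgebra R Y) (FreeAlgebra R Y)).comp
      (FreeAlgebra.lift R fun y => (TrivSqZeroExt.inl (FreeAlgebra.ι R y) +
      TrivSqZeroExt.inr (FreeAlgebra.ι R (s y)) :
        TrivSqZeroExt (FreeAlgebra R Y) (FreeAlgebra R Y)))) = AlgHom.id R _ := by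
    ext y
    simp
  have h' := fun r => DFunLike.congr_fun h r
  simp only [AlgHom.comp_apply, AlgHom.id_apply, TrivSqZeroExt.fstHom_apply] at h'
  simp [shiftDerivation, h', -DualNumber.inr_eq_smul_eps]

/-- The iterated bracket `[…[[v, a], a], …, a]` with `k` entries `a`. -/
def rightBracket {A : Type*} [Ring A] (a v : A) : ℕ → A
  | 0 => v
  | k + 1 => rightBracket a v k * a - a * rightBracket a v k

theorem map_rightBracket {A A' : Type*} [Ring A] [Ring A'] (f : A →+* A') (a v : A) (k : ℕ) :
    f (rightBracket a v k) = rightBracket (f a) (f v) k := by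
  induction k with
  | zero => rfl
  | succ k ih => simp [rightBracket, ih]

/-- A family of elements of an algebra is free if its noncommutative monomials are linearly
independent. -/
def IsFreeFamily (R : Type*) [CommRing R] {B A : Type*} [Ring A] [Algebra R A] (u : B → A) :
    Prop :=
  Function.Injective (FreeAlgebra.lift R u)

theorem isFreeFamily_ι (R : Type*) [CommRing R] (B : Type*) :
    IsFreeFamily R (FreeAlgebra.ι R : B → FreeAlgebra R B) := by
  have : FreeAlgebra.lift R (FreeAlgebra.ι R : B → FreeAlgebra R B) = AlgHom.id R _ := by
    ext; simp
  rw [IsFreeFamily, this]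
  exact Function.injective_id

/-- Let the free algebra on `B` act on the free algebra on the symbols `(b, k)`: `a` acts as minus
the derivation raising `k`, and `b ≠ a` as left multiplication by `(b, 0)`. The commutator of a left
multiplication with `-δ` is left multiplication by the derivative, so the `k`-fold bracket acts as
multiplication by `(b, k)`. Evaluation at `1` then recovers any polynomial in these brackets. -/
theorem isFreeFamily_rightBracket_ι (R : Type*) [CommRing R] {B : Type*} (a : B) :
    IsFreeFamily R fun p : {b // b ≠ a} × ℕ =>
      rightBracket (FreeAlgebra.ι R a) (FreeAlgebra.ι R p.1.1) p.2 := by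
  classical
  set δ : Module.End R (FreeAlgebra R ({b // b ≠ a} × ℕ)) :=
    shiftDerivation R fun p => (p.1, p.2 + 1) with hδ
  let ψ : FreeAlgebra R B →ₐ[R] Module.End R (FreeAlgebra R ({b // b ≠ a} × ℕ)) :=
    FreeAlgebra.lift R fun b =>
      if h : b = a then -δ else LinearMap.mulLeft R (FreeAlgebra.ι R (⟨b, h⟩, 0))
  have hψ : ∀ p : {b // b ≠ a} × ℕ,
      ψ (rightBracket (FreeAlgebra.ι R a) (FreeAlgebra.ι R p.1.1) p.2) =
        LinearMap.mulLeft R (FreeAlgebra.ι R p) := by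
    rintro ⟨b, k⟩
    induction k with
    | zero => simp [rightBracket, ψ, b.2]
    | succ k ih =>
      have ha : ψ (FreeAlgebra.ι R a) = -δ := by simp [ψ]
      simp only [rightBracket, map_sub, map_mul]
      simp only at ih
      rw [ih, ha]
      ext1 z
      simp [hδ, shiftDerivation_mul, shiftDerivation_ι]
  have hcomp : ψ.comp (FreeAlgebra.lift R fun p : {b // b ≠ a} × ℕ =>
      rightBracket (FreeAlgebra.ι R a) (FreeAlgebra.ι R p.1.1) p.2) =
      Algebra.lmul R _ := by
    ext1
    funext p
    simp only [Function.comp_apply, AlgHom.comp_apply, FreeAlgebra.lift_ι_apply, hψ]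
    rfl
  intro p q hpq
  have := DFunLike.congr_fun hcomp p
  have h2 := DFunLike.congr_fun hcomp q
  simp only [AlgHom.comp_apply] at this h2
  rw [hpq, h2] at this
  simpa using (DFunLike.congr_fun this 1).symm

theorem IsFreeFamily.rightBracket {R : Type*} [CommRing R] {B A : Type*} [Ring A] [Algebra R A]
    {u : B → A} (hu : IsFreeFamily R u) (a : B) :
    IsFreeFamily R fun p : {b // b ≠ a} × ℕ => rightBracket (u a) (u p.1.1) p.2 := by
  have : (FreeAlgebra.lift R fun p : {b // b ≠ a} × ℕ => _root_.rightBracket (u a) (u p.1.1) p.2) =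
      (FreeAlgebra.lift R u).comp (FreeAlgebra.lift R fun p : {b // b ≠ a} × ℕ =>
        _root_.rightBracket (FreeAlgebra.ι R a) (FreeAlgebra.ι R p.1.1) p.2) := by
    ext p
    have := map_rightBracket (FreeAlgebra.lift R u).toRingHom (FreeAlgebra.ι R a)
      (FreeAlgebra.ι R p.1.1) p.2
    simpa using this.symm
  rw [IsFreeFamily, this]
  exact hu.comp (isFreeFamily_rightBracket_ι R a)

theorem IsFreeFamily.comp_injective {R : Type*} [CommRing R] {B C A : Type*} [Ring A]
    [Algebra R A] {u : B → A} (hu : IsFreeFamily R u) {f : C → B} (hf : Function.Injective f) :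
    IsFreeFamily R (u ∘ f) := by
  classical
  have h : FreeAlgebra.lift R (u ∘ f) =
      (FreeAlgebra.lift R u).comp (FreeAlgebra.lift R (FreeAlgebra.ι R ∘ f)) := by
    ext; simp
  have h2 : (FreeAlgebra.lift R fun b => if hb : ∃ c, f c = b then FreeAlgebra.ι R hb.choose
      else 0).comp (FreeAlgebra.lift R (FreeAlgebra.ι R ∘ f)) = AlgHom.id R (FreeAlgebra R C) := by
    ext c
    have hc : ∃ c', f c' = f c := ⟨c, rfl⟩
    have := hf hc.choose_spec
    simp [hf.eq_iff]
  rw [IsFreeFamily, h]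
  refine hu.comp ?_
  exact Function.LeftInverse.injective (g := _) fun x => DFunLike.congr_fun h2 x

theorem basisFreeMonoid_of (R : Type*) [CommRing R] {B : Type*} (b : B) :
    FreeAlgebra.basisFreeMonoid R B (FreeMonoid.of b) = FreeAlgebra.ι R b := by
  apply (FreeAlgebra.equivMonoidAlgebraFreeMonoid (R := R) (X := B)).injective
  simp [FreeAlgebra.basisFreeMonoid]
  simp [FreeAlgebra.equivMonoidAlgebraFreeMonoid]

theorem IsFreeFamily.linearIndependent {R : Type*} [CommRing R] {B A : Type*} [Ring A]
    [Algebra R A] {u : B → A} (hu : IsFreeFamily R u) : LinearIndependent R u := by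
  have h : LinearIndependent R (FreeAlgebra.ι R : B → FreeAlgebra R B) := by
    have := (FreeAlgebra.basisFreeMonoid R B).linearIndependent.comp FreeMonoid.of
      FreeMonoid.of_injective
    convert this using 1
    funext b
    exact (basisFreeMonoid_of R b).symm
  have := h.map' (FreeAlgebra.lift R u).toLinearMap (LinearMap.ker_eq_bot.2 hu)
  simpa [Function.comp_def] using this

/-! ### The lower central series and leading terms of power series -/

-- Induction on `j` by the three subgroups lemma, applied in the quotient by the target term.
open Subgroup in
theorem commutator_lowerCentralSeries_le {G : Type*} [Group G] (i j : ℕ) :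
    ⁅(⊤ : Subgroup G).lowerCentralSeries i, (⊤ : Subgroup G).lowerCentralSeries j⁆ ≤
      (⊤ : Subgroup G).lowerCentralSeries (i + j + 1) := by
  induction j generalizing i with
  | zero => exact le_rfl
  | succ j ih =>
    set N := (⊤ : Subgroup G).lowerCentralSeries (i + (j + 1) + 1) with hN
    have key : ∀ H : Subgroup G, H ≤ N ↔ H.map (QuotientGroup.mk' N) = ⊥ := by
      intro H
      rw [Subgroup.map_eq_bot_iff, QuotientGroup.ker_mk']
    rw [commutator_comm, Subgroup.lowerCentralSeries_succ, key, map_commutator, map_commutator]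
    apply commutator_commutator_eq_bot_of_rotate
    · rw [← map_commutator, ← map_commutator, ← key, commutator_comm ⊤]
      refine (ih (i + 1)).trans (le_of_eq ?_)
      rw [hN]
      congr 1
      omega
    · rw [← map_commutator, ← map_commutator, ← key]
      exact (commutator_mono (ih i) le_rfl)

theorem one_add_mul_one_add_of_commute {S : Type*} [Ring S] {x y a b : S} (hxy : Commute x y)
    (ha : Commute a y) (hb : Commute b x) :
    (1 + x * a) * (1 + y * b) = (1 + y * b) * (1 + x * a) + x * y * (a * b - b * a) := by
  have e2 : x * a * (y * b) = x * y * (a * b) := by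
    rw [mul_assoc, ← mul_assoc a, ha.eq]; simp only [mul_assoc]
  have e3 : y * b * (x * a) = x * y * (b * a) := by
    rw [mul_assoc, ← mul_assoc b, hb.eq, hxy.eq]; simp only [mul_assoc]
  simp only [mul_add, add_mul, one_mul, mul_one, mul_sub, e2, e3]
  abel

/-- The power series `p` has the form `1 + u * t ^ k + …`. -/
def LeadingTerm {A : Type*} [Ring A] (k : ℕ) (u : A) (p : A⟦X⟧) : Prop :=
  ∃ a : A⟦X⟧, p = 1 + PowerSeries.X ^ k * a ∧ PowerSeries.constantCoeff a = u

namespace LeadingTerm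

variable {A : Type*} [Ring A] {k l : ℕ} {u v : A} {p q : A⟦X⟧}

theorem one (k : ℕ) : LeadingTerm k (0 : A) 1 := ⟨0, by simp, by simp⟩

theorem constantCoeff (h : LeadingTerm (k + 1) u p) : PowerSeries.constantCoeff p = 1 := by
  obtain ⟨a, rfl, -⟩ := h
  simp [pow_succ]

theorem coeff (h : LeadingTerm (k + 1) u p) : PowerSeries.coeff (k + 1) p = u := by
  obtain ⟨a, rfl, rfl⟩ := h
  simp [PowerSeries.coeff_X_pow_mul', PowerSeries.coeff_one]

theorem unique (h : LeadingTerm (k + 1) u p) (h' : LeadingTerm (k + 1) v p) : u = v :=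
  h.coeff.symm.trans h'.coeff

theorem mono (h : LeadingTerm l v p) (hkl : k < l) : LeadingTerm k 0 p := by
  obtain ⟨a, rfl, -⟩ := h
  obtain ⟨m, rfl⟩ := Nat.exists_eq_add_of_lt hkl
  exact ⟨PowerSeries.X ^ (m + 1) * a, by rw [← mul_assoc, ← pow_add, add_assoc],
    by simp [pow_succ]⟩

theorem exists_of_zero (h : LeadingTerm k 0 p) : ∃ v, LeadingTerm (k + 1) v p := by
  obtain ⟨a, rfl, ha⟩ := h
  obtain ⟨b, rfl⟩ := PowerSeries.X_dvd_iff.2 ha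
  exact ⟨_, b, by rw [pow_succ, mul_assoc], rfl⟩

theorem mul (hp : LeadingTerm (k + 1) u p) (hq : LeadingTerm (k + 1) v q) :
    LeadingTerm (k + 1) (u + v) (p * q) := by
  obtain ⟨a, rfl, rfl⟩ := hp
  obtain ⟨b, rfl, rfl⟩ := hq
  refine ⟨a + b + PowerSeries.X ^ (k + 1) * (a * b), ?_, by simp [pow_succ]⟩
  have : a * PowerSeries.X ^ (k + 1) = PowerSeries.X ^ (k + 1) * a :=
    PowerSeries.commute_X_pow a (k + 1)
  simp only [mul_add, add_mul, one_mul, mul_one, mul_assoc]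
  rw [← mul_assoc a, this, mul_assoc]
  abel

theorem inv {p : A⟦X⟧ˣ} (hp : LeadingTerm (k + 1) u (p : A⟦X⟧)) :
    LeadingTerm (k + 1) (-u) ((p⁻¹ : A⟦X⟧ˣ) : A⟦X⟧) := by
  have h1 : PowerSeries.constantCoeff ((p⁻¹ : A⟦X⟧ˣ) : A⟦X⟧) = 1 := by
    have := congrArg PowerSeries.constantCoeff (p.mul_inv)
    rwa [map_mul, hp.constantCoeff, one_mul, map_one] at this
  obtain ⟨a, ha, rfl⟩ := hp
  refine ⟨-(a * ((p⁻¹ : A⟦X⟧ˣ) : A⟦X⟧)), ?_, by simp [h1]⟩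
  have := p.mul_inv
  nth_rewrite 1 [ha] at this
  rw [add_mul, one_mul, mul_assoc] at this
  rw [mul_neg, ← sub_eq_add_neg]
  exact eq_sub_of_add_eq this

theorem zpow {p : A⟦X⟧ˣ} (hp : LeadingTerm (k + 1) u (p : A⟦X⟧)) (e : ℤ) :
    LeadingTerm (k + 1) (e • u) ((p ^ e : A⟦X⟧ˣ) : A⟦X⟧) := by
  induction e with
  | zero => simpa using one (k + 1)
  | succ i ih =>
    rw [zpow_add_one, add_smul, one_smul]
    exact ih.mul hp
  | pred i ih =>
    rw [zpow_sub_one, sub_smul, one_smul, sub_eq_add_neg]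
    exact ih.mul hp.inv

/-- From $pq=qp+t^{k+l+2}(ab-ba)$ one gets $[p,q]=1+t^{k+l+2}(ab-ba)\,p^{-1}q^{-1}$, and the
inverses have constant term $1$. -/
theorem commutator {p q : A⟦X⟧ˣ} (hp : LeadingTerm (k + 1) u (p : A⟦X⟧))
    (hq : LeadingTerm (l + 1) v (q : A⟦X⟧)) :
    LeadingTerm (k + 1 + (l + 1)) (u * v - v * u) ((⁅p, q⁆ : A⟦X⟧ˣ) : A⟦X⟧) := by
  have h1 := hp.inv.constantCoeff
  have h2 := hq.inv.constantCoeff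
  obtain ⟨a, ha, rfl⟩ := hp
  obtain ⟨b, hb, rfl⟩ := hq
  refine ⟨(a * b - b * a) * (((p⁻¹ : A⟦X⟧ˣ) : A⟦X⟧) * ((q⁻¹ : A⟦X⟧ˣ) : A⟦X⟧)), ?_,
    by simp [h1, h2]⟩
  have e1 := one_add_mul_one_add_of_commute (a := a) (b := b)
    ((Commute.refl PowerSeries.X).pow_pow (k + 1) (l + 1))
    (PowerSeries.commute_X_pow a (l + 1)) (PowerSeries.commute_X_pow b (k + 1))
  rw [← ha, ← hb, ← pow_add] at e1
  rw [commutatorElement_def, Units.val_mul, Units.val_mul, Units.val_mul, e1, mul_assoc, add_mul,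
    ← mul_assoc (_ ^ _)]
  congr 1
  rw [mul_assoc, ← mul_assoc (p : A⟦X⟧), Units.mul_inv, one_mul, Units.mul_inv]

end LeadingTerm

theorem exists_leadingTerm_of_mem_lowerCentralSeries {G A : Type*} [Group G] [Ring A]
    (φ : G →* A⟦X⟧ˣ) (hφ : ∀ g, ∃ v, LeadingTerm 1 v (φ g : A⟦X⟧)) (n : ℕ) :
    ∀ w ∈ (⊤ : Subgroup G).lowerCentralSeries n, ∃ v, LeadingTerm (n + 1) v (φ w : A⟦X⟧) := by
  induction n with
  | zero => exact fun w _ => hφ w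
  | succ n ih =>
    intro w hw
    rw [Subgroup.lowerCentralSeries_succ] at hw
    induction hw using Subgroup.closure_induction with
    | mem x hx =>
      obtain ⟨g, hg, h, -, rfl⟩ := hx
      obtain ⟨u, hu⟩ := ih g hg
      obtain ⟨v, hv⟩ := hφ h
      rw [map_commutatorElement]
      exact ⟨_, hu.commutator (l := 0) hv⟩
    | one => exact ⟨0, by simpa using LeadingTerm.one _⟩
    | mul x y _ _ hx hy =>
      obtain ⟨u, hu⟩ := hx
      obtain ⟨v, hv⟩ := hy
      exact ⟨_, by simpa using hu.mul hv⟩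
    | inv x _ hx =>
      obtain ⟨u, hu⟩ := hx
      exact ⟨_, by simpa using hu.inv⟩

/-! ### The elimination process in groups -/

/-- If `a` normalizes `M`, then the elements `a ^ e * m` with `m ∈ M` form a subgroup. -/
theorem exists_eq_zpow_mul {G : Type*} [Group G] {a : G} {M : Subgroup G} {S : Set G}
    (ha : a ∈ Subgroup.normalizer (M : Set G)) (hS : ∀ x ∈ S, x = a ∨ x ∈ M)
    {w : G} (hw : w ∈ Subgroup.closure S ⊔ M) : ∃ e : ℤ, ∃ m ∈ M, w = a ^ e * m := by
  have h1 : w ∈ Subgroup.zpowers a ⊔ M := by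
    refine (sup_le ((Subgroup.closure_le _).2 fun x hx => ?_) le_sup_right) hw
    rcases hS x hx with rfl | h
    · exact Subgroup.mem_sup_left (Subgroup.mem_zpowers x)
    · exact Subgroup.mem_sup_right h
  have h2 := Subgroup.coe_mul_of_left_le_normalizer_right (Subgroup.zpowers a) M
    (by simpa using ha)
  rw [← SetLike.mem_coe, h2] at h1
  obtain ⟨_, ⟨e, rfl⟩, m, hm, rfl⟩ := h1
  exact ⟨e, m, hm, rfl⟩

/-- Conjugation by `a` preserves the subgroup generated by the iterated commutators with `a`,
provided that these are eventually in `N`. -/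
theorem mem_normalizer_of_commutator_chain {G C : Type*} [Group G] {a : G} {N : Subgroup G}
    [N.Normal] {s : C × ℕ → G} (hs : ∀ c k, s (c, k + 1) = ⁅s (c, k), a⁆) {n : ℕ}
    (hn : ∀ c k, n ≤ k → s (c, k) ∈ N) :
    a ∈ Subgroup.normalizer ((Subgroup.closure (Set.range s) ⊔ N : Subgroup G) : Set G) := by
  set M := Subgroup.closure (Set.range s) ⊔ N
  have hsM : ∀ p, s p ∈ M := fun p =>
    Subgroup.mem_sup_left (Subgroup.subset_closure ⟨p, rfl⟩)
  have key : ∀ b : G, (∀ p, b * s p * b⁻¹ ∈ M) → ∀ x ∈ M, b * x * b⁻¹ ∈ M := by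
    intro b hb x hx
    have : M ≤ M.comap (MulAut.conj b).toMonoidHom := by
      refine sup_le ((Subgroup.closure_le _).2 ?_) fun x hx => ?_
      · rintro _ ⟨p, rfl⟩
        exact hb p
      · exact Subgroup.mem_sup_right (Subgroup.Normal.conj_mem inferInstance x hx b)
    exact this hx
  have h1 : ∀ p, a * s p * a⁻¹ ∈ M := by
    rintro ⟨c, k⟩
    have : a * s (c, k) * a⁻¹ = (s (c, k + 1))⁻¹ * s (c, k) := by
      rw [hs, commutatorElement_def]; group
    rw [this]
    exact M.mul_mem (M.inv_mem (hsM _)) (hsM _)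
  -- Conjugating $s_k$ by $a^{-1}$ brings in the conjugate of $s_{k+1}$; the recursion stops because
  -- the chain eventually enters the normal subgroup `N`. Here `j` bounds the number of steps left.
  have h2 : ∀ p, a⁻¹ * s p * a⁻¹⁻¹ ∈ M := by
    rintro ⟨c, k⟩
    have : ∀ j k, n ≤ k + j → a⁻¹ * s (c, k) * a⁻¹⁻¹ ∈ M := by
      intro j
      induction j with
      | zero =>
        exact fun k hk => Subgroup.mem_sup_right
          (Subgroup.Normal.conj_mem inferInstance _ (hn c k hk) _)
      | succ j ih =>
        intro k hk
        have e : a⁻¹ * s (c, k) * a⁻¹⁻¹ = a⁻¹ * s (c, k + 1) * a⁻¹⁻¹ * s (c, k) := by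
          rw [hs, commutatorElement_def]; group
        rw [e]
        exact M.mul_mem (ih _ (by omega)) (hsM _)
    exact this n k (by omega)
  rw [Subgroup.mem_normalizer_iff]
  intro x
  refine ⟨key a h1 x, fun hx => ?_⟩
  have := key a⁻¹ h2 _ hx
  simpa [mul_assoc] using this

/-- Only finitely many iterated brackets have a given depth. -/
theorem finite_setOf_bracketDepth_eq {B : Type*} {d : B → ℕ} (hd : ∀ m, {b | d b = m}.Finite)
    (a : B) (m : ℕ) :
    {p : {b // b ≠ a} × ℕ | d p.1.1 + p.2 * (d a + 1) = m}.Finite := by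
  have h1 : {b : {b // b ≠ a} | d b.1 ≤ m}.Finite := by
    have : {b | d b ≤ m}.Finite := by
      have := Set.Finite.biUnion (Set.finite_Iic m) fun i _ => hd i
      refine this.subset fun b hb => ?_
      simpa using hb
    exact this.preimage Subtype.val_injective.injOn
  refine (h1.prod (Set.finite_Iic m)).subset ?_
  rintro ⟨b, k⟩ h
  simp only [Set.mem_ofPred_eq] at h
  have : k ≤ k * (d a + 1) := Nat.le_mul_of_pos_right k (Nat.succ_pos _)
  simp only [Set.mem_prod, Set.mem_ofPred_eq, Set.mem_Iic]
  omega

section MagnusWitt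

variable {G A R : Type*} [Group G] [Ring A] [CommRing R] [Algebra R A]

/-- A family of group elements whose images have free leading terms. -/
structure IsLeadingFamily (R : Type*) [CommRing R] [Algebra R A] (φ : G →* A⟦X⟧ˣ) {B : Type*}
    (g : B → G) (d : B → ℕ) (u : B → A) : Prop where
  mem : ∀ b, g b ∈ (⊤ : Subgroup G).lowerCentralSeries (d b)
  leadingTerm : ∀ b, LeadingTerm (d b + 1) (u b) (φ (g b) : A⟦X⟧)
  free : IsFreeFamily R u
  finite : ∀ m, {b | d b = m}.Finite

/-- Iterated group commutator `⁅…⁅x, a⁆…, a⁆`. -/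
def rightCommutator (a x : G) : ℕ → G
  | 0 => x
  | k + 1 => ⁅rightCommutator a x k, a⁆

theorem IsLeadingFamily.eliminate {φ : G →* A⟦X⟧ˣ} {B : Type*} {g : B → G} {d : B → ℕ}
    {u : B → A} (h : IsLeadingFamily R φ g d u) (a : B) :
    IsLeadingFamily R φ (fun p : {b // b ≠ a} × ℕ => rightCommutator (g a) (g p.1.1) p.2)
      (fun p => d p.1.1 + p.2 * (d a + 1)) (fun p => rightBracket (u a) (u p.1.1) p.2) where
  mem := by
    rintro ⟨b, k⟩
    induction k with
    | zero => simpa [rightCommutator] using h.mem b.1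
    | succ k ih =>
      have := commutator_lowerCentralSeries_le _ _ (Subgroup.commutator_mem_commutator ih (h.mem a))
      convert this using 2
      · simp only
        ring
      · rfl
  leadingTerm := by
    rintro ⟨b, k⟩
    induction k with
    | zero => simpa [rightCommutator, rightBracket] using h.leadingTerm b.1
    | succ k ih =>
      have := ih.commutator (h.leadingTerm a)
      rw [← map_commutatorElement] at this
      convert this using 1
      · simp only
        ring
      · rfl
      · rfl
  free := h.free.rightBracket a
  finite := finite_setOf_bracketDepth_eq h.finite a

/-- Elements generated by a family of depth at least `m`, where only depth `m` contributes to the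
leading term. -/
theorem IsLeadingFamily.exists_mem_span {φ : G →* A⟦X⟧ˣ}
    (hφ : ∀ g, ∃ v, LeadingTerm 1 v (φ g : A⟦X⟧)) {C : Type*} {g : C → G} {d : C → ℕ}
    {u : C → A} (h : IsLeadingFamily R φ g d u) {m n : ℕ} (hmn : m < n) (hm : ∀ c, m ≤ d c)
    {w : G} (hw : w ∈ Subgroup.closure (Set.range g) ⊔ (⊤ : Subgroup G).lowerCentralSeries n) :
    ∃ v ∈ Submodule.span R (u '' {c | d c = m}), LeadingTerm (m + 1) v (φ w : A⟦X⟧) := by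
  let S : Subgroup G :=
    { carrier := {w | ∃ v ∈ Submodule.span R (u '' {c | d c = m}),
        LeadingTerm (m + 1) v (φ w : A⟦X⟧)}
      one_mem' := ⟨0, Submodule.zero_mem _, by simpa using LeadingTerm.one _⟩
      mul_mem' := by
        rintro x y ⟨v, hv, hx⟩ ⟨v', hv', hy⟩
        exact ⟨v + v', Submodule.add_mem _ hv hv', by simpa using hx.mul hy⟩
      inv_mem' := by
        rintro x ⟨v, hv, hx⟩
        exact ⟨-v, Submodule.neg_mem _ hv, by simpa using hx.inv⟩ }
  suffices Subgroup.closure (Set.range g) ⊔ (⊤ : Subgroup G).lowerCentralSeries n ≤ S from this hw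
  refine sup_le ((Subgroup.closure_le _).2 ?_) fun x hx => ?_
  · rintro _ ⟨c, rfl⟩
    rcases (hm c).eq_or_lt with hc | hc
    · exact ⟨u c, Submodule.subset_span ⟨c, hc.symm, rfl⟩, hc ▸ h.leadingTerm c⟩
    · exact ⟨0, Submodule.zero_mem _, (h.leadingTerm c).mono (by omega)⟩
  · obtain ⟨v, hv⟩ := exists_leadingTerm_of_mem_lowerCentralSeries φ hφ n x hx
    exact ⟨0, Submodule.zero_mem _, hv.mono (by omega)⟩

/-- Generators of minimal depth are eliminated one at a time. Splitting off the generator `a` writes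
`w` as a power of `g a` times an element of the eliminated family; freeness of the leading terms
forces the exponent to be zero, so `w` is already generated by the brackets. Each pass lowers the
number of generators of minimal depth, and when none is left the bound `m` on the depths rises. -/
theorem IsLeadingFamily.mem_lowerCentralSeries [CharZero R] {φ : G →* A⟦X⟧ˣ}
    (hφ : ∀ g, ∃ v, LeadingTerm 1 v (φ g : A⟦X⟧)) (n : ℕ) {B : Type*} {g : B → G} {d : B → ℕ}
    {u : B → A} (h : IsLeadingFamily R φ g d u) {w : G}
    (hw : w ∈ Subgroup.closure (Set.range g) ⊔ (⊤ : Subgroup G).lowerCentralSeries n)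
    {v : A} (hv : LeadingTerm (n + 1) v (φ w : A⟦X⟧)) :
    w ∈ (⊤ : Subgroup G).lowerCentralSeries n := by
  obtain ⟨j, m, hj, hm⟩ : ∃ j m, n ≤ m + j ∧ ∀ b, m ≤ d b := ⟨n, 0, by omega, by simp⟩
  induction j generalizing m B g d u w v with
  | zero =>
    refine (sup_le ((Subgroup.closure_le _).2 ?_) le_rfl) hw
    rintro _ ⟨b, rfl⟩
    exact Subgroup.lowerCentralSeries_antitone _ (by have := hm b; omega) (h.mem b)
  | succ j ih =>
    obtain ⟨N, hN⟩ : ∃ N, {b | d b = m}.ncard = N := ⟨_, rfl⟩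
    induction N using Nat.strong_induction_on generalizing B g d u w v with
    | _ N ihN =>
      by_cases hne : ∃ a, d a = m
      swap
      · push Not at hne
        exact ih h hw hv (m + 1) (by omega) fun b => lt_of_le_of_ne (hm b) (hne b).symm
      obtain ⟨a, ha⟩ := hne
      by_cases hmn : n ≤ m
      · exact ih h hw hv m (by omega) hm
      have h' := h.eliminate a
      have hnorm := mem_normalizer_of_commutator_chain (a := g a)
        (s := fun p : {b // b ≠ a} × ℕ => rightCommutator (g a) (g p.1.1) p.2)
        (N := (⊤ : Subgroup G).lowerCentralSeries n) (fun c k => rfl) (n := n) (fun c k hk =>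
          Subgroup.lowerCentralSeries_antitone _ (by
            have : k ≤ k * (d a + 1) := Nat.le_mul_of_pos_right k (Nat.succ_pos _)
            simp only
            omega) (h'.mem (c, k)))
      obtain ⟨e, x, hx, rfl⟩ := exists_eq_zpow_mul hnorm (S := Set.range g) (w := w) (by
        rintro _ ⟨b, rfl⟩
        by_cases hb : b = a
        · exact Or.inl (hb ▸ rfl)
        · exact Or.inr (Subgroup.mem_sup_left (Subgroup.subset_closure ⟨(⟨b, hb⟩, 0), rfl⟩)))
        (SetLike.le_def.1 (sup_le_sup_left le_sup_right _) hw)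
      have hm' : ∀ p : {b // b ≠ a} × ℕ, m ≤ d p.1.1 + p.2 * (d a + 1) :=
        fun p => (hm p.1.1).trans (Nat.le_add_right _ _)
      obtain ⟨y, hy, hxy⟩ := h'.exists_mem_span hφ (not_le.1 hmn) hm' hx
      have hlead : LeadingTerm (m + 1) (e • u a + y) (φ (g a ^ e * x) : A⟦X⟧) := by
        have := (ha ▸ h.leadingTerm a).zpow e
        simpa using this.mul hxy
      have hzero := hlead.unique (hv.mono (by omega))
      -- In the minimal depth `m` only brackets with `k = 0` occur, so `y` is a combination of
      -- leading terms of generators other than `a`. Linear independence and characteristic zero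
      -- give the claim.
      have he : e = 0 := by
        have hsub : y ∈ Submodule.span R (u '' (Set.univ \ {a})) := by
          refine Submodule.span_mono ?_ hy
          rintro _ ⟨⟨b, k⟩, hk, rfl⟩
          have hk0 : k = 0 := by
            by_contra hk0
            have : 1 * (d a + 1) ≤ k * (d a + 1) :=
              Nat.mul_le_mul_right _ (Nat.one_le_iff_ne_zero.2 hk0)
            have := hm b.1
            simp only [Set.mem_ofPred_eq] at hk
            omega
          subst hk0
          exact ⟨b.1, ⟨trivial, b.2⟩, rfl⟩
        have := linearIndependent_iff_eq_zero_of_smul_mem_span.1 h.free.linearIndependent a (e : R)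
          (by
            have : (e : R) • u a = -y := by
              rw [← eq_neg_iff_add_eq_zero] at hzero
              rw [← hzero, Int.cast_smul_eq_zsmul]
            rw [this]
            exact Submodule.neg_mem _ hsub)
        exact_mod_cast this
      subst he
      rw [zpow_zero, one_mul] at hv ⊢
      -- The brackets of depth `m` are the old generators of depth `m` except `a`.
      refine ihN _ ?_ h' hx hv hm' rfl
      rw [← hN]
      have hinj : Set.InjOn (fun p : {b // b ≠ a} × ℕ => p.1.1)
          {p | d p.1.1 + p.2 * (d a + 1) = m} := by
        rintro ⟨b, k⟩ hk ⟨b', k'⟩ hk' hbb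
        simp only [Set.mem_ofPred_eq] at hk hk' hbb
        have hb := hm b.1
        have hb' := hm b'.1
        have e1 : k * (d a + 1) = 0 := by omega
        have e2 : k' * (d a + 1) = 0 := by omega
        simp only [mul_eq_zero, Nat.add_eq_zero_iff, one_ne_zero, and_false, or_false] at e1 e2
        rw [e1, e2, Subtype.ext hbb]
      rw [← hinj.ncard_image]
      refine Set.ncard_lt_ncard ?_ (h.finite m)
      rw [Set.ssubset_iff_of_subset]
      · refine ⟨a, ha, ?_⟩
        rintro ⟨p, -, hp⟩
        exact p.1.2 hp
      · rintro _ ⟨p, hp, rfl⟩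
        have := hm p.1.1
        simp only [Set.mem_ofPred_eq] at hp ⊢
        omega

end MagnusWitt

/-! ### The Magnus expansion and the Magnus–Witt theorem -/

section Magnus

variable (R : Type*) [CommRing R] (X : Type*)

/-- The Magnus homomorphism `x ↦ 1 + t * x`. -/
noncomputable def magnus : FreeGroup X →* (FreeAlgebra R X)⟦X⟧ˣ :=
  FreeGroup.lift fun x =>
    { val := 1 + PowerSeries.X * PowerSeries.C (FreeAlgebra.ι R x)
      inv := PowerSeries.invOfUnit (1 + PowerSeries.X * PowerSeries.C (FreeAlgebra.ι R x)) 1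
      val_inv := PowerSeries.mul_invOfUnit _ _ (by simp)
      inv_val := PowerSeries.invOfUnit_mul _ _ (by simp) }

variable {X}

theorem magnus_of (x : X) : (magnus R X (FreeGroup.of x) : (FreeAlgebra R X)⟦X⟧) =
    1 + PowerSeries.X * PowerSeries.C (FreeAlgebra.ι R x) := by
  simp [magnus]

theorem leadingTerm_magnus_of (x : X) :
    LeadingTerm (0 + 1) (FreeAlgebra.ι R x)
      (magnus R X (FreeGroup.of x) : (FreeAlgebra R X)⟦X⟧) :=
  ⟨_, by rw [magnus_of, zero_add, pow_one], by simp⟩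

theorem exists_leadingTerm_magnus (w : FreeGroup X) :
    ∃ v, LeadingTerm 1 v (magnus R X w : (FreeAlgebra R X)⟦X⟧) := by
  induction w using FreeGroup.induction_on with
  | C1 => exact ⟨0, by simpa using LeadingTerm.one 1⟩
  | of x => exact ⟨_, leadingTerm_magnus_of R x⟩
  | inv_of x _ => exact ⟨_, by simpa using (leadingTerm_magnus_of R x).inv⟩
  | mul x y hx hy =>
    obtain ⟨u, hu⟩ := hx
    obtain ⟨v, hv⟩ := hy
    exact ⟨_, by simpa using hu.mul (k := 0) hv⟩

theorem exists_finite_mem_closure_of (w : FreeGroup X) :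
    ∃ s : Set X, s.Finite ∧ w ∈ Subgroup.closure (Set.range fun x : s => FreeGroup.of x.1) := by
  induction w using FreeGroup.induction_on with
  | C1 => exact ⟨∅, Set.finite_empty, one_mem _⟩
  | of x => exact ⟨{x}, Set.finite_singleton x, Subgroup.subset_closure ⟨⟨x, rfl⟩, rfl⟩⟩
  | inv_of x h =>
    obtain ⟨s, hs, h⟩ := h
    exact ⟨s, hs, inv_mem h⟩
  | mul x y hx hy =>
    obtain ⟨s, hs, hx⟩ := hx
    obtain ⟨t, ht, hy⟩ := hy
    refine ⟨s ∪ t, hs.union ht, mul_mem (Subgroup.closure_mono ?_ hx)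
      (Subgroup.closure_mono ?_ hy)⟩
    · rintro _ ⟨x, rfl⟩
      exact ⟨⟨x.1, Or.inl x.2⟩, rfl⟩
    · rintro _ ⟨x, rfl⟩
      exact ⟨⟨x.1, Or.inr x.2⟩, rfl⟩

/-- The Magnus–Witt theorem: the dimension subgroups of a free group are the terms of its lower
central series. -/
theorem mem_lowerCentralSeries_of_leadingTerm [CharZero R] {n : ℕ} {w : FreeGroup X}
    {v : FreeAlgebra R X} (hv : LeadingTerm (n + 1) v (magnus R X w : (FreeAlgebra R X)⟦X⟧)) :
    w ∈ (⊤ : Subgroup (FreeGroup X)).lowerCentralSeries n := by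
  obtain ⟨s, hs, hw⟩ := exists_finite_mem_closure_of w
  have : Finite s := hs
  have h : IsLeadingFamily R (magnus R X) (fun x : s => FreeGroup.of x.1) (fun _ => 0)
      (fun x => FreeAlgebra.ι R x.1) :=
    { mem := fun _ => trivial
      leadingTerm := fun x => leadingTerm_magnus_of R x.1
      free := (isFreeFamily_ι R X).comp_injective Subtype.val_injective
      finite := fun _ => Set.toFinite _ }
  exact h.mem_lowerCentralSeries (exists_leadingTerm_magnus R) n (Subgroup.mem_sup_left hw) hv

/-- The leading term of the Magnus expansion of an element of the lower central series. -/
noncomputable def lieTerm (n : ℕ) (w : FreeGroup X) : FreeAlgebra R X :=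
  PowerSeries.coeff (n + 1) (magnus R X w : (FreeAlgebra R X)⟦X⟧)

theorem leadingTerm_lieTerm {n : ℕ} {w : FreeGroup X}
    (hw : w ∈ (⊤ : Subgroup (FreeGroup X)).lowerCentralSeries n) :
    LeadingTerm (n + 1) (lieTerm R n w) (magnus R X w : (FreeAlgebra R X)⟦X⟧) := by
  obtain ⟨v, hv⟩ := exists_leadingTerm_of_mem_lowerCentralSeries (magnus R X)
    (exists_leadingTerm_magnus R) n w hw
  rwa [lieTerm, hv.coeff]

variable {R}

theorem lieTerm_mul {n : ℕ} {v w : FreeGroup X}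
    (hv : v ∈ (⊤ : Subgroup (FreeGroup X)).lowerCentralSeries n)
    (hw : w ∈ (⊤ : Subgroup (FreeGroup X)).lowerCentralSeries n) :
    lieTerm R n (v * w) = lieTerm R n v + lieTerm R n w := by
  have := ((leadingTerm_lieTerm R hv).mul (leadingTerm_lieTerm R hw)).coeff
  simpa [lieTerm] using this

theorem lieTerm_inv {n : ℕ} {v : FreeGroup X}
    (hv : v ∈ (⊤ : Subgroup (FreeGroup X)).lowerCentralSeries n) :
    lieTerm R n v⁻¹ = -lieTerm R n v := by
  have := (leadingTerm_lieTerm R hv).inv.coeff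
  simpa [lieTerm] using this

theorem lieTerm_eq_zero_iff [CharZero R] {n : ℕ} {w : FreeGroup X}
    (hw : w ∈ (⊤ : Subgroup (FreeGroup X)).lowerCentralSeries n) :
    lieTerm R n w = 0 ↔ w ∈ (⊤ : Subgroup (FreeGroup X)).lowerCentralSeries (n + 1) := by
  constructor
  · intro h
    have h1 := leadingTerm_lieTerm R hw
    rw [h] at h1
    obtain ⟨v, hv⟩ := h1.exists_of_zero
    exact mem_lowerCentralSeries_of_leadingTerm R hv
  · intro h
    exact ((leadingTerm_lieTerm R h).mono (Nat.lt_succ_self _)).coeff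

theorem basisFreeMonoid_mul (v w : FreeMonoid X) :
    FreeAlgebra.basisFreeMonoid R X v * FreeAlgebra.basisFreeMonoid R X w =
      FreeAlgebra.basisFreeMonoid R X (v * w) := by
  apply (FreeAlgebra.equivMonoidAlgebraFreeMonoid (R := R) (X := X)).injective
  simp [FreeAlgebra.basisFreeMonoid]

theorem repr_mul_ι (u : FreeAlgebra R X) (x : X) (w : FreeMonoid X) :
    (FreeAlgebra.basisFreeMonoid R X).repr (u * FreeAlgebra.ι R x) (w * FreeMonoid.of x) =
      (FreeAlgebra.basisFreeMonoid R X).repr u w := by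
  classical
  have : (Finsupp.lapply (w * FreeMonoid.of x)).comp
      ((FreeAlgebra.basisFreeMonoid R X).repr.toLinearMap.comp
        (LinearMap.mulRight R (FreeAlgebra.ι R x))) =
      (Finsupp.lapply w).comp (FreeAlgebra.basisFreeMonoid R X).repr.toLinearMap := by
    apply (FreeAlgebra.basisFreeMonoid R X).ext
    intro v
    simp [← basisFreeMonoid_of, basisFreeMonoid_mul, Finsupp.single_apply]
  exact DFunLike.congr_fun this u

theorem repr_ι_mul (u : FreeAlgebra R X) {x y : X} (hxy : y ≠ x) (w : FreeMonoid X) :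
    (FreeAlgebra.basisFreeMonoid R X).repr (FreeAlgebra.ι R x * u) (FreeMonoid.of y * w) = 0 := by
  classical
  have : (Finsupp.lapply (FreeMonoid.of y * w)).comp
      ((FreeAlgebra.basisFreeMonoid R X).repr.toLinearMap.comp
        (LinearMap.mulLeft R (FreeAlgebra.ι R x))) = 0 := by
    apply (FreeAlgebra.basisFreeMonoid R X).ext
    intro v
    simp only [LinearMap.comp_apply, LinearMap.mulLeft_apply, ← basisFreeMonoid_of,
      basisFreeMonoid_mul, LinearEquiv.coe_coe, Module.Basis.repr_self, Finsupp.lapply_apply,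
      LinearMap.zero_apply]
    rw [Finsupp.single_apply, if_neg]
    intro h
    have := congrArg FreeMonoid.toList h
    simp at this
    exact hxy this.1.symm
  exact DFunLike.congr_fun this u

/-- In a free algebra on at least two letters only the scalars commute with all letters. -/
theorem eq_zero_of_commute_ι [Nontrivial X] {u : FreeAlgebra R X}
    (hu : ∀ x, u * FreeAlgebra.ι R x = FreeAlgebra.ι R x * u)
    (h0 : FreeAlgebra.algebraMapInv u = 0) : u = 0 := by
  have h1 : ∀ w : FreeMonoid X, w ≠ 1 → (FreeAlgebra.basisFreeMonoid R X).repr u w = 0 := by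
    intro w hw
    obtain ⟨y, w', rfl⟩ : ∃ y w', w = FreeMonoid.of y * w' := by
      cases w using FreeMonoid.casesOn with
      | one => exact absurd rfl hw
      | of_mul y w' => exact ⟨y, w', rfl⟩
    obtain ⟨x, hx⟩ := exists_ne y
    -- The coefficient of $yw'$ in $u$ is that of $yw'x$ in $ux=xu$, where every word begins with
    -- $x\ne y$.
    rw [← repr_mul_ι u x, hu x, mul_assoc, repr_ι_mul u hx.symm]
  have h2 : u = algebraMap R _ ((FreeAlgebra.basisFreeMonoid R X).repr u 1) := by
    apply (FreeAlgebra.basisFreeMonoid R X).repr.injective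
    have h3 : (1 : FreeAlgebra R X) = FreeAlgebra.basisFreeMonoid R X 1 := by
      apply (FreeAlgebra.equivMonoidAlgebraFreeMonoid (R := R) (X := X)).injective
      simp [FreeAlgebra.basisFreeMonoid, MonoidAlgebra.one_def]
    rw [Algebra.algebraMap_eq_smul_one, map_smul, h3, Module.Basis.repr_self]
    ext w
    by_cases hw : w = 1
    · subst hw; simp
    · rw [h1 w hw]; simp [Ne.symm hw]
  rw [h2] at h0 ⊢
  rw [FreeAlgebra.algebraMap_leftInverse] at h0
  rw [h0, map_zero]

/-- The augmentation kills all letters, hence sends every Magnus expansion to `1`. -/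
theorem algebraMapInv_lieTerm (n : ℕ) (w : FreeGroup X) :
    FreeAlgebra.algebraMapInv (lieTerm R n w) = 0 := by
  have h : (Units.map (PowerSeries.map
      (FreeAlgebra.algebraMapInv (R := R) (X := X)).toRingHom).toMonoidHom).comp (magnus R X) =
      1 := by
    ext1 x
    ext1
    simp [magnus_of, FreeAlgebra.algebraMapInv]
  have := congrArg (fun p : R⟦X⟧ˣ => PowerSeries.coeff (n + 1) (p : R⟦X⟧))
    (DFunLike.congr_fun h w)
  simpa [lieTerm, PowerSeries.coeff_one] using this

variable (X) in
/-- An element of a free group that is central modulo a term of the lower central series lies in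
the previous term. -/
theorem mem_lowerCentralSeries_of_commutator_mem [Nontrivial X] {n : ℕ} {w : FreeGroup X}
    (hw : ∀ v, ⁅w, v⁆ ∈ (⊤ : Subgroup (FreeGroup X)).lowerCentralSeries (n + 1)) :
    w ∈ (⊤ : Subgroup (FreeGroup X)).lowerCentralSeries n := by
  suffices ∀ k ≤ n, w ∈ (⊤ : Subgroup (FreeGroup X)).lowerCentralSeries k from this n le_rfl
  intro k
  induction k with
  | zero => exact fun _ => trivial
  | succ k ih =>
    intro hk
    have hwk := ih (Nat.le_of_succ_le hk)
    rw [← lieTerm_eq_zero_iff (R := ℚ) hwk]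
    -- The brackets of the leading term of `w` with the letters are coefficients of commutators
    -- lying deeper in the series, so they vanish.
    refine eq_zero_of_commute_ι (fun x => ?_) (algebraMapInv_lieTerm k w)
    have h1 := (leadingTerm_lieTerm ℚ hwk).commutator (leadingTerm_magnus_of ℚ x)
    rw [← map_commutatorElement] at h1
    have h2 := (leadingTerm_lieTerm ℚ (hw (FreeGroup.of x))).mono
      (k := k + 1 + (0 + 1)) (by omega)
    exact sub_eq_zero.1 (h1.unique h2)

end Magnus

/-! ### Integral Lie polynomials and their multidegrees -/

section LieMonomials

variable (R : Type*) [CommRing R] {X : Type*}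

/-- Left-normed Lie monomials of degree `n + 1`, with the multiset of their letters. -/
inductive IsLieMonomial : ℕ → Multiset X → FreeAlgebra R X → Prop
  | letter (x : X) : IsLieMonomial 0 {x} (FreeAlgebra.ι R x)
  | bracket {n : ℕ} {α : Multiset X} {u : FreeAlgebra R X} (x : X) (h : IsLieMonomial n α u) :
      IsLieMonomial (n + 1) (x ::ₘ α) (u * FreeAlgebra.ι R x - FreeAlgebra.ι R x * u)

/-- The additive group of integral Lie polynomials of degree `n + 1`. -/
def lieSpan (X : Type*) (n : ℕ) : AddSubgroup (FreeAlgebra R X) :=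
  AddSubgroup.closure {u | ∃ α, IsLieMonomial R n α u}

variable {R}

theorem bracket_mem_lieSpan {n : ℕ} {u v : FreeAlgebra R X} (hu : u ∈ lieSpan R X n)
    (hv : v ∈ lieSpan R X 0) : u * v - v * u ∈ lieSpan R X (n + 1) := by
  induction hu using AddSubgroup.closure_induction with
  | mem u hu =>
    obtain ⟨α, hu⟩ := hu
    induction hv using AddSubgroup.closure_induction with
    | mem v hv =>
      obtain ⟨β, hv⟩ := hv
      cases hv with
      | letter x => exact AddSubgroup.subset_closure ⟨_, hu.bracket x⟩
    | zero => simp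
    | add v w _ _ hv hw =>
      convert add_mem hv hw using 1
      noncomm_ring
    | neg v _ hv =>
      convert neg_mem hv using 1
      noncomm_ring
  | zero => simp
  | add u w _ _ hu hw =>
    convert add_mem hu hw using 1
    noncomm_ring
  | neg u _ hu =>
    convert neg_mem hu using 1
    noncomm_ring

theorem exists_mem_lieSpan_zero (w : FreeGroup X) : ∃ v ∈ lieSpan R X 0,
    LeadingTerm (0 + 1) v (magnus R X w : (FreeAlgebra R X)⟦X⟧) := by
  induction w using FreeGroup.induction_on with
  | C1 => exact ⟨0, zero_mem _, by simpa using LeadingTerm.one 1⟩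
  | of x =>
    exact ⟨_, AddSubgroup.subset_closure ⟨_, IsLieMonomial.letter x⟩, leadingTerm_magnus_of R x⟩
  | inv_of x h =>
    obtain ⟨u, hu, h⟩ := h
    exact ⟨-u, neg_mem hu, by simpa using h.inv⟩
  | mul x y hx hy =>
    obtain ⟨u, hu, hx⟩ := hx
    obtain ⟨v, hv, hy⟩ := hy
    exact ⟨u + v, add_mem hu hv, by simpa using hx.mul hy⟩

theorem lieTerm_mem_lieSpan {n : ℕ} {w : FreeGroup X}
    (hw : w ∈ (⊤ : Subgroup (FreeGroup X)).lowerCentralSeries n) :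
    lieTerm R n w ∈ lieSpan R X n := by
  suffices ∃ u ∈ lieSpan R X n, LeadingTerm (n + 1) u (magnus R X w : (FreeAlgebra R X)⟦X⟧) by
    obtain ⟨u, hu, h⟩ := this
    rwa [lieTerm, h.coeff]
  induction n generalizing w with
  | zero => exact exists_mem_lieSpan_zero w
  | succ n ih =>
    rw [Subgroup.lowerCentralSeries_succ] at hw
    induction hw using Subgroup.closure_induction with
    | mem x hx =>
      obtain ⟨g, hg, h, -, rfl⟩ := hx
      obtain ⟨u, hu, hgu⟩ := ih hg
      obtain ⟨v, hv, hhv⟩ := exists_mem_lieSpan_zero (R := R) h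
      rw [map_commutatorElement]
      exact ⟨_, bracket_mem_lieSpan hu hv, hgu.commutator hhv⟩
    | one => exact ⟨0, zero_mem _, by simpa using LeadingTerm.one _⟩
    | mul x y _ _ hx hy =>
      obtain ⟨u, hu, hx⟩ := hx
      obtain ⟨v, hv, hy⟩ := hy
      exact ⟨u + v, add_mem hu hv, by simpa using hx.mul hy⟩
    | inv x _ h =>
      obtain ⟨u, hu, h⟩ := h
      exact ⟨-u, neg_mem hu, by simpa using h.inv⟩

/-- Group commutators realize Lie brackets. With `lieTerm_mem_lieSpan` this identifies the leading
terms of a lower central term with an additive lattice rather than an `R`-module, so that solutions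
found among Lie polynomials come from group elements. -/
theorem exists_lieTerm_eq {n : ℕ} {u : FreeAlgebra R X} (hu : u ∈ lieSpan R X n) :
    ∃ w ∈ (⊤ : Subgroup (FreeGroup X)).lowerCentralSeries n, lieTerm R n w = u := by
  induction hu using AddSubgroup.closure_induction with
  | mem u hu =>
    obtain ⟨α, hu⟩ := hu
    induction hu with
    | letter x => exact ⟨FreeGroup.of x, trivial, (leadingTerm_magnus_of R x).coeff⟩
    | bracket x _ ih =>
      obtain ⟨w, hw, rfl⟩ := ih
      refine ⟨⁅w, FreeGroup.of x⁆, Subgroup.commutator_mem_commutator hw trivial, ?_⟩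
      have := (leadingTerm_lieTerm R hw).commutator (leadingTerm_magnus_of R x)
      rw [← map_commutatorElement] at this
      exact this.coeff
  | zero => exact ⟨1, one_mem _, by
    simp [lieTerm, PowerSeries.coeff_one]⟩
  | add u v _ _ hu hv =>
    obtain ⟨g, hg, rfl⟩ := hu
    obtain ⟨h, hh, rfl⟩ := hv
    exact ⟨g * h, mul_mem hg hh, lieTerm_mul hg hh⟩
  | neg u _ hu =>
    obtain ⟨g, hg, rfl⟩ := hu
    exact ⟨g⁻¹, inv_mem hg, lieTerm_inv hg⟩

/-- The multiset of letters of a word. -/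
def wordLetters (w : FreeMonoid X) : Multiset X := (w.toList : Multiset X)

theorem IsLieMonomial.mem_span {n : ℕ} {α : Multiset X} {u : FreeAlgebra R X}
    (h : IsLieMonomial R n α u) :
    u ∈ Submodule.span R (FreeAlgebra.basisFreeMonoid R X '' {w | wordLetters w = α}) := by
  induction h with
  | letter x =>
    refine Submodule.subset_span ⟨FreeMonoid.of x, ?_, basisFreeMonoid_of R x⟩
    simp [wordLetters]
  | @bracket n α u x _ ih =>
    refine sub_mem ?_ ?_
    · have := Submodule.mem_map_of_mem (f := LinearMap.mulRight R (FreeAlgebra.ι R x)) ih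
      rw [Submodule.map_span] at this
      refine Submodule.span_mono ?_ this
      rintro _ ⟨_, ⟨w, hw, rfl⟩, rfl⟩
      refine ⟨w * FreeMonoid.of x, ?_, ?_⟩
      · rw [Set.mem_ofPred_eq] at hw ⊢
        rw [← hw]
        simp [wordLetters, ← Multiset.coe_add, add_comm, ← Multiset.singleton_add]
      · simp [← basisFreeMonoid_mul, basisFreeMonoid_of]
    · have := Submodule.mem_map_of_mem (f := LinearMap.mulLeft R (FreeAlgebra.ι R x)) ih
      rw [Submodule.map_span] at this
      refine Submodule.span_mono ?_ this
      rintro _ ⟨_, ⟨w, hw, rfl⟩, rfl⟩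
      refine ⟨FreeMonoid.of x * w, ?_, ?_⟩
      · rw [Set.mem_ofPred_eq] at hw ⊢
        rw [← hw]
        simp [wordLetters]
      · simp [← basisFreeMonoid_mul, basisFreeMonoid_of]

theorem IsLieMonomial.wordLetters_eq {n : ℕ} {α : Multiset X} {u : FreeAlgebra R X}
    (h : IsLieMonomial R n α u) {w : FreeMonoid X}
    (hw : (FreeAlgebra.basisFreeMonoid R X).repr u w ≠ 0) : wordLetters w = α :=
  (Module.Basis.mem_span_image _).1 h.mem_span (Finsupp.mem_support_iff.2 hw)

theorem IsLieMonomial.commute_of_forall_eq {n : ℕ} {α : Multiset X} {u : FreeAlgebra R X}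
    (h : IsLieMonomial R n α u) {x : X} (hx : ∀ y ∈ α, y = x) :
    Commute u (FreeAlgebra.ι R x) := by
  induction h with
  | letter y => rw [hx y (Multiset.mem_singleton_self y)]
  | bracket y _ ih =>
    rw [hx y (Multiset.mem_cons_self _ _),
      (ih fun z hz => hx z (Multiset.mem_cons_of_mem hz)).eq, sub_self]
    exact Commute.zero_left _

theorem IsLieMonomial.eq_zero_of_forall_eq {n : ℕ} {α : Multiset X} {u : FreeAlgebra R X}
    (h : IsLieMonomial R (n + 1) α u) {x : X} (hx : ∀ y ∈ α, y = x) : u = 0 := by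
  cases h with
  | bracket y h =>
    rw [hx y (Multiset.mem_cons_self _ _),
      (h.commute_of_forall_eq fun z hz => hx z (Multiset.mem_cons_of_mem hz)).eq, sub_self]

/-- The integral Lie polynomials of degree `n + 1`, as functions on words. -/
noncomputable def lieCoeffs (R : Type*) [CommRing R] (X : Type*) (n : ℕ) :
    AddSubgroup (FreeMonoid X →₀ R) :=
  (lieSpan R X n).map (FreeAlgebra.basisFreeMonoid R X).repr.toAddEquiv.toAddMonoidHom

theorem mem_lieCoeffs {n : ℕ} {f : FreeMonoid X →₀ R} : f ∈ lieCoeffs R X n ↔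
    ∃ w ∈ (⊤ : Subgroup (FreeGroup X)).lowerCentralSeries n,
      (FreeAlgebra.basisFreeMonoid R X).repr (lieTerm R n w) = f := by
  constructor
  · rintro ⟨u, hu, rfl⟩
    obtain ⟨w, hw, rfl⟩ := exists_lieTerm_eq hu
    exact ⟨w, hw, rfl⟩
  · rintro ⟨w, hw, rfl⟩
    exact ⟨_, lieTerm_mem_lieSpan hw, rfl⟩

-- Lie monomials are multihomogeneous, so each multihomogeneous component of an integral combination
-- of them is again such a combination.
open Classical in
theorem filter_mem_lieCoeffs {n : ℕ} {f : FreeMonoid X →₀ R} (hf : f ∈ lieCoeffs R X n)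
    (α : Multiset X) : f.filter (fun w => wordLetters w = α) ∈ lieCoeffs R X n := by
  obtain ⟨u, hu, rfl⟩ := hf
  induction hu using AddSubgroup.closure_induction with
  | mem u hu =>
    obtain ⟨β, hβ⟩ := hu
    by_cases hαβ : β = α
    · subst hαβ
      refine ⟨u, AddSubgroup.subset_closure ⟨β, hβ⟩, ?_⟩
      symm
      exact Finsupp.filter_eq_self_iff _ _ |>.2 fun w hw => hβ.wordLetters_eq hw
    · convert zero_mem (lieCoeffs R X n)
      exact Finsupp.filter_eq_zero_iff _ _ |>.2 fun w hw => by
        by_contra h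
        exact hαβ ((hβ.wordLetters_eq h).symm.trans hw)
  | zero => simp [Finsupp.filter_zero, zero_mem]
  | add u v _ _ hu hv =>
    convert add_mem hu hv using 1
    rw [← Finsupp.filter_add]
    congr 1
    exact map_add _ u v
  | neg u _ hu =>
    convert neg_mem hu using 1
    rw [← Finsupp.filter_neg]
    congr 1
    exact map_neg _ u

/-- A word that occurs in a Lie polynomial of degree at least two has distinct letters. -/
theorem exists_ne_of_mem_lieCoeffs {n : ℕ} {f : FreeMonoid X →₀ R}
    (hf : f ∈ lieCoeffs R X (n + 1)) {w : FreeMonoid X} (hw : f w ≠ 0) (x : X) :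
    ∃ y ∈ wordLetters w, y ≠ x := by
  by_contra! hx
  apply hw
  clear hw
  obtain ⟨u, hu, rfl⟩ := hf
  induction hu using AddSubgroup.closure_induction with
  | mem u hu =>
    obtain ⟨β, hβ⟩ := hu
    by_contra h
    have := hβ.wordLetters_eq h
    subst this
    rw [hβ.eq_zero_of_forall_eq hx] at h
    simp at h
  | zero => simp
  | add u v _ _ hu hv => rw [map_add, Finsupp.add_apply, hu, hv, add_zero]
  | neg u _ hu => rw [map_neg, Finsupp.neg_apply, hu, neg_zero]

theorem magnus_map {Y : Type*} (σ : X → Y) (w : FreeGroup X) :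
    (magnus R Y (FreeGroup.map σ w) : (FreeAlgebra R Y)⟦X⟧) =
      PowerSeries.map (FreeAlgebra.lift R (FreeAlgebra.ι R ∘ σ)).toRingHom
        (magnus R X w : (FreeAlgebra R X)⟦X⟧) := by
  have h : (magnus R Y).comp (FreeGroup.map σ) = (Units.map (PowerSeries.map
      (FreeAlgebra.lift R (FreeAlgebra.ι R ∘ σ)).toRingHom).toMonoidHom).comp (magnus R X) := by
    ext1 x
    ext1
    simp [magnus_of]
  exact congrArg Units.val (DFunLike.congr_fun h w)

theorem repr_lieTerm_map (σ : X → X) (n : ℕ) (w : FreeGroup X) :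
    (FreeAlgebra.basisFreeMonoid R X).repr (lieTerm R n (FreeGroup.map σ w)) =
      Finsupp.mapDomain (FreeMonoid.map σ)
        ((FreeAlgebra.basisFreeMonoid R X).repr (lieTerm R n w)) := by
  rw [lieTerm, magnus_map, PowerSeries.coeff_map, ← lieTerm]
  generalize lieTerm R n w = u
  have h1 : ∀ v, FreeAlgebra.lift R (FreeAlgebra.ι R ∘ σ) (FreeAlgebra.basisFreeMonoid R X v) =
      FreeAlgebra.basisFreeMonoid R X (FreeMonoid.map σ v) := by
    have h0 : FreeAlgebra.basisFreeMonoid R X 1 = 1 := by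
      apply (FreeAlgebra.equivMonoidAlgebraFreeMonoid (R := R) (X := X)).injective
      simp [FreeAlgebra.basisFreeMonoid, MonoidAlgebra.one_def]
    intro v
    induction v using FreeMonoid.inductionOn' with
    | one => simp [h0]
    | of_mul x v ih =>
      rw [← basisFreeMonoid_mul, map_mul, ih, map_mul, ← basisFreeMonoid_mul, basisFreeMonoid_of]
      simp [basisFreeMonoid_of]
  have : ((FreeAlgebra.basisFreeMonoid R X).repr.toLinearMap.comp
      (FreeAlgebra.lift R (FreeAlgebra.ι R ∘ σ)).toLinearMap) =
      (Finsupp.lmapDomain R R (FreeMonoid.map σ)).comp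
        (FreeAlgebra.basisFreeMonoid R X).repr.toLinearMap := by
    apply (FreeAlgebra.basisFreeMonoid R X).ext
    intro v
    simp [h1, Finsupp.mapDomain_single]
  exact DFunLike.congr_fun this u

end LieMonomials

/-! ### Vanishing of orbit sums in the presence of roots -/

section OrbitSums

variable {W M : Type*} [AddCommGroup M] {p : Equiv.Perm W}

theorem injective_zpow_apply {w : W} (hw : ∀ k : ℤ, (p ^ k) w = w → k = 0) :
    Function.Injective fun k : ℤ => (p ^ k) w := by
  intro i j hij
  have : (p ^ (-j + i)) w = w := by
    rw [zpow_add, Equiv.Perm.mul_apply]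
    simp only at hij
    rw [hij, ← Equiv.Perm.mul_apply, ← zpow_add, neg_add_cancel, zpow_zero, Equiv.Perm.one_apply]
  have := hw _ this
  omega

theorem hasFiniteSupport_orbit (f : W →₀ M) {w : W} (hw : ∀ k : ℤ, (p ^ k) w = w → k = 0) :
    (fun k : ℤ => f ((p ^ k) w)).HasFiniteSupport :=
  Set.Finite.preimage (injective_zpow_apply hw).injOn f.hasFiniteSupport

theorem finsum_orbit_mapDomain (s : W →₀ M) (w : W) :
    ∑ᶠ k : ℤ, Finsupp.mapDomain p s ((p ^ k) w) = ∑ᶠ k : ℤ, s ((p ^ k) w) := by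
  rw [← finsum_comp_equiv (Equiv.addLeft (1 : ℤ))]
  refine finsum_congr fun k => ?_
  rw [Finsupp.mapDomain_equiv_apply, Equiv.coe_addLeft, zpow_add, zpow_one]
  simp

theorem finsum_orbit_add (f g : W →₀ M) {w : W} (hw : ∀ k : ℤ, (p ^ k) w = w → k = 0) :
    ∑ᶠ k : ℤ, (f + g) ((p ^ k) w) = ∑ᶠ k : ℤ, f ((p ^ k) w) + ∑ᶠ k : ℤ, g ((p ^ k) w) := by
  rw [← finsum_add_distrib (hasFiniteSupport_orbit f hw) (hasFiniteSupport_orbit g hw)]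
  rfl

/-- If `u` is invariant, up to coboundaries of `p`, under an `n`-th root of `p` for all `n`, then
its sums over free orbits of `p` vanish. -/
theorem finsum_orbit_eq_zero {u : W →₀ M}
    (hroot : ∀ n : ℕ, 2 ≤ n → ∃ r : Equiv.Perm W, r ^ n = p ∧ ∃ s : W →₀ M,
      s + Finsupp.mapDomain r u = u + Finsupp.mapDomain p s)
    {w : W} (hw : ∀ k : ℤ, (p ^ k) w = w → k = 0) : ∑ᶠ k : ℤ, u ((p ^ k) w) = 0 := by
  by_contra hne
  -- A root of degree larger than the size of the support; the summand `2` also meets the bound on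
  -- the degree.
  obtain ⟨r, rfl, s, hs⟩ := hroot (u.support.card + 2) (by omega)
  set n := u.support.card + 2 with hn
  have hfree : ∀ i : ℤ, ∀ k : ℤ, ((r ^ n) ^ k) ((r ^ i) w) = (r ^ i) w → k = 0 := by
    intro i k h
    apply hw k
    apply (r ^ i).injective
    rw [← h, ← Equiv.Perm.mul_apply, ← Equiv.Perm.mul_apply, ← zpow_natCast, ← zpow_mul,
      ← zpow_add, ← zpow_add, add_comm]
  -- Summing the relation over a `p`-orbit cancels `s` against its translate, so the orbit sum is
  -- the same at $r^iw$ and at $r^{i-1}w$.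
  have hstep : ∀ i : ℤ, ∑ᶠ k : ℤ, u (((r ^ n) ^ k) ((r ^ i) w)) =
      ∑ᶠ k : ℤ, u (((r ^ n) ^ k) ((r ^ (i - 1)) w)) := by
    intro i
    have h1 : ∑ᶠ k : ℤ, (s + Finsupp.mapDomain r u) (((r ^ n) ^ k) ((r ^ i) w)) =
        ∑ᶠ k : ℤ, (u + Finsupp.mapDomain (r ^ n) s) (((r ^ n) ^ k) ((r ^ i) w)) := by rw [hs]
    rw [finsum_orbit_add _ _ (hfree i), finsum_orbit_add _ _ (hfree i), finsum_orbit_mapDomain,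
      add_comm, add_left_inj] at h1
    rw [← h1]
    refine finsum_congr fun k => ?_
    rw [Finsupp.mapDomain_equiv_apply, ← Equiv.Perm.inv_def, ← Equiv.Perm.mul_apply,
      ← Equiv.Perm.mul_apply, ← Equiv.Perm.mul_apply, ← zpow_natCast, ← zpow_mul, ← zpow_add,
      ← zpow_neg_one, ← zpow_add, ← zpow_add]
    congr 3
    ring
  have hall : ∀ i : ℕ, ∑ᶠ k : ℤ, u (((r ^ n) ^ k) ((r ^ (-i : ℤ)) w)) ≠ 0 := by
    intro i
    induction i with
    | zero => simpa using hne
    | succ i ih =>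
      rw [hstep] at ih
      convert ih using 8
      push_cast
      ring
  have hex : ∀ i : ℕ, ∃ k : ℤ, (r ^ ((n : ℤ) * k - i)) w ∈ u.support := by
    intro i
    obtain ⟨k, hk⟩ : ∃ k : ℤ, u (((r ^ n) ^ k) ((r ^ (-i : ℤ)) w)) ≠ 0 := by
      by_contra! h
      exact hall i (finsum_eq_zero_of_forall_eq_zero h)
    refine ⟨k, Finsupp.mem_support_iff.2 ?_⟩
    rwa [← Equiv.Perm.mul_apply, ← zpow_natCast, ← zpow_mul, ← zpow_add, ← sub_eq_add_neg] at hk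
  choose k hk using hex
  -- Each of the orbits of $r^{-i}w$, $0\le i<n$, meets the support. By pigeonhole two of them meet
  -- it in the same point, and freeness then gives $n\mid i-j$.
  obtain ⟨i, hi, j, hj, hij, he⟩ := Finset.exists_ne_map_eq_of_card_lt_of_maps_to
    (s := Finset.range n) (t := u.support) (by rw [Finset.card_range]; omega)
    (f := fun i => (r ^ ((n : ℤ) * k i - i)) w) (fun i _ => hk i)
  rw [Finset.mem_range] at hi hj
  set a := (n : ℤ) * k i - i with ha
  set b := (n : ℤ) * k j - j with hb
  have hfix : (r ^ (-b + a)) w = w := by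
    rw [zpow_add, Equiv.Perm.mul_apply, he, ← Equiv.Perm.mul_apply, ← zpow_add, neg_add_cancel,
      zpow_zero, Equiv.Perm.one_apply]
  have h0 : -b + a = 0 := by
    apply hw
    rw [← zpow_natCast, ← zpow_mul, mul_comm, zpow_mul, zpow_natCast]
    exact Equiv.Perm.pow_apply_eq_self_of_apply_eq_self hfix n
  have h1 : (n : ℤ) * (k i - k j) = i - j := by
    rw [mul_sub]; omega
  have h2 : (i : ℤ) - j = 0 := Int.eq_zero_of_abs_lt_dvd ⟨_, h1.symm⟩ (by
    rw [abs_lt]; omega)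
  omega

end OrbitSums

/-! ### Coboundaries inside an invariant lattice -/

section Coboundary

variable {W V M : Type*} [AddCommGroup M] {p : Equiv.Perm W} {L : AddSubgroup (W →₀ M)}

/-- Telescoping: for $k\ge 0$ take $v=f+pf+\dots+p^{k-1}f$, and similarly for negative powers. -/
theorem exists_zpow_coboundary (hL : ∀ k : ℤ, ∀ f ∈ L, Finsupp.mapDomain (p ^ k) f ∈ L)
    (k : ℤ) {f : W →₀ M} (hf : f ∈ L) :
    ∃ v ∈ L, Finsupp.mapDomain (p ^ k) f - f = Finsupp.mapDomain p v - v := by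
  have hcomp : ∀ k : ℤ, Finsupp.mapDomain (p ^ (k + 1)) f =
      Finsupp.mapDomain p (Finsupp.mapDomain (p ^ k) f) := by
    intro k
    rw [← Finsupp.mapDomain_comp, ← Equiv.Perm.coe_mul, add_comm, zpow_add, zpow_one]
  induction k with
  | zero => exact ⟨0, zero_mem _, by simp [Finsupp.mapDomain_zero, Finsupp.mapDomain_id]⟩
  | succ i ih =>
    obtain ⟨v, hv, h⟩ := ih
    refine ⟨Finsupp.mapDomain (p ^ (i : ℤ)) f + v, add_mem (hL _ f hf) hv, ?_⟩
    rw [hcomp, Finsupp.mapDomain_add, add_sub_add_comm, ← h]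
    abel
  | pred i ih =>
    obtain ⟨v, hv, h⟩ := ih
    refine ⟨v - Finsupp.mapDomain (p ^ (-(i : ℤ) - 1)) f, sub_mem hv (hL _ f hf), ?_⟩
    have h1 := hcomp (-(i : ℤ) - 1)
    rw [sub_add_cancel] at h1
    rw [sub_eq_add_neg v, Finsupp.mapDomain_add]
    have h2 : ∀ g : W →₀ M, Finsupp.mapDomain p (-g) = -Finsupp.mapDomain p g :=
      fun g => map_neg (Finsupp.mapDomain.addMonoidHom p) g
    rw [h2, ← h1, add_sub_add_comm, ← h]
    abel

-- Induction on the number of degrees in the support of `u`. A component is translated onto another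
-- degree of its orbit that already occurs; this changes `u` by a coboundary from `L`, keeps the
-- orbit sums, and empties one degree without creating a new one.
open Classical in
theorem exists_eq_coboundary {d : W → V} {q : Equiv.Perm V} (hd : ∀ w, d (p w) = q (d w))
    (hL : ∀ k : ℤ, ∀ f ∈ L, Finsupp.mapDomain (p ^ k) f ∈ L)
    (hfilter : ∀ f ∈ L, ∀ α, f.filter (fun w => d w = α) ∈ L) {u : W →₀ M} (hu : u ∈ L)
    (hfree : ∀ w, u w ≠ 0 → ∀ k : ℤ, (q ^ k) (d w) = d w → k = 0)
    (hsum : ∀ w, (∀ k : ℤ, (q ^ k) (d w) = d w → k = 0) → ∑ᶠ k : ℤ, u ((p ^ k) w) = 0) :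
    ∃ v ∈ L, u = Finsupp.mapDomain p v - v := by
  have hdz : ∀ (k : ℤ) w, d ((p ^ k) w) = (q ^ k) (d w) := by
    intro k
    induction k with
    | zero => simp
    | succ i ih =>
      intro w
      rw [zpow_add_one, zpow_add_one, Equiv.Perm.mul_apply, ih, hd, Equiv.Perm.mul_apply]
    | pred i ih =>
      intro w
      rw [zpow_sub_one, zpow_sub_one, Equiv.Perm.mul_apply, ih, Equiv.Perm.mul_apply]
      congr 1
      rw [Equiv.Perm.eq_inv_iff_eq, ← hd]
      simp
  have hpfree : ∀ w, (∀ k : ℤ, (q ^ k) (d w) = d w → k = 0) →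
      ∀ k : ℤ, (p ^ k) w = w → k = 0 := by
    intro w hw k hk
    apply hw
    rw [← hdz, hk]
  obtain ⟨N, hN⟩ : ∃ N, (u.support.image d).card = N := ⟨_, rfl⟩
  induction N using Nat.strong_induction_on generalizing u with
  | _ N ih =>
    by_cases hu0 : u = 0
    · exact ⟨0, zero_mem _, by simp [hu0, Finsupp.mapDomain_zero]⟩
    obtain ⟨w₀, hw₀⟩ := Finsupp.ne_iff.1 hu0
    rw [Finsupp.zero_apply] at hw₀
    -- Since the orbit sum is zero, a nonzero value at `w₀` cannot be the only one on its orbit.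
    have hk : ∃ k : ℤ, k ≠ 0 ∧ u ((p ^ k) w₀) ≠ 0 := by
      by_contra! h
      have := hsum w₀ (hfree w₀ hw₀)
      rw [finsum_eq_single _ 0 h] at this
      exact hw₀ (by simpa using this)
    obtain ⟨k, hk0, hk⟩ := hk
    set α := d w₀ with hα
    have hne : (q ^ k) α ≠ α := fun h => hk0 (hfree w₀ hw₀ k h)
    set a := u.filter (fun w => d w = α) with ha
    have haL : a ∈ L := hfilter u hu α
    obtain ⟨v₁, hv₁, hv₁'⟩ := exists_zpow_coboundary hL k haL
    have happ : ∀ w, (u + (Finsupp.mapDomain (p ^ k) a - a)) w =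
        (if d w = α then 0 else u w) + (if d w = (q ^ k) α then u ((p ^ (-k)) w) else 0) := by
      intro w
      rw [Finsupp.add_apply, Finsupp.sub_apply, Finsupp.mapDomain_equiv_apply, ha,
        Finsupp.filter_apply, Finsupp.filter_apply, ← Equiv.Perm.inv_def, ← zpow_neg, hdz]
      have : (q ^ (-k)) (d w) = α ↔ d w = (q ^ k) α := by
        rw [zpow_neg, Equiv.Perm.inv_eq_iff_eq, eq_comm]
      simp only [this]
      by_cases h1 : d w = α <;> simp [h1]
    have hsub : ∀ w, (u + (Finsupp.mapDomain (p ^ k) a - a)) w ≠ 0 →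
        d w ≠ α ∧ d w ∈ u.support.image d := by
      intro w hw
      rw [happ] at hw
      by_cases h1 : d w = α
      · rw [if_pos h1, if_neg (by rw [h1]; exact hne.symm)] at hw
        simp at hw
      · refine ⟨h1, ?_⟩
        by_cases h2 : d w = (q ^ k) α
        · rw [h2, hα, ← hdz]
          exact Finset.mem_image_of_mem d (Finsupp.mem_support_iff.2 hk)
        · rw [if_neg h1, if_neg h2, add_zero] at hw
          exact Finset.mem_image_of_mem d (Finsupp.mem_support_iff.2 hw)
    have hcard : ((u + (Finsupp.mapDomain (p ^ k) a - a)).support.image d).card < N := by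
      rw [← hN]
      refine Finset.card_lt_card (Finset.ssubset_iff_of_subset ?_ |>.2 ⟨α, ?_, ?_⟩)
      · intro β hβ
        obtain ⟨w, hw, rfl⟩ := Finset.mem_image.1 hβ
        exact (hsub w (Finsupp.mem_support_iff.1 hw)).2
      · exact Finset.mem_image_of_mem d (Finsupp.mem_support_iff.2 hw₀)
      · intro hβ
        obtain ⟨w, hw, hwα⟩ := Finset.mem_image.1 hβ
        exact (hsub w (Finsupp.mem_support_iff.1 hw)).1 hwα
    obtain ⟨v, hv, hv'⟩ := ih _ hcard (add_mem hu (sub_mem (hL k a haL) haL))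
      (fun w hw => by
        obtain ⟨w', hw', h⟩ := Finset.mem_image.1 (hsub w hw).2
        rw [← h]
        exact hfree w' (Finsupp.mem_support_iff.1 hw'))
      (fun w hw => by
        rw [hv₁', finsum_orbit_add _ _ (hpfree w hw), hsum w hw, zero_add, sub_eq_add_neg,
          finsum_orbit_add _ _ (hpfree w hw), finsum_orbit_mapDomain,
          ← finsum_orbit_add _ _ (hpfree w hw)]
        simp) rfl
    refine ⟨v - v₁, sub_mem hv hv₁, ?_⟩
    rw [hv₁'] at hv'
    have h2 : Finsupp.mapDomain p (v - v₁) = Finsupp.mapDomain p v - Finsupp.mapDomain p v₁ :=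
      map_sub (Finsupp.mapDomain.addMonoidHom p) v v₁
    rw [h2, eq_sub_of_add_eq hv']
    abel

end Coboundary

/-! ### Bases of free nilpotent groups and of their inner automorphism groups -/

section NilpotentFamilies

theorem ker_conj {G : Type*} [Group G] :
    (MulAut.conj : G →* MulAut G).ker = Subgroup.center G := by
  ext z
  rw [MonoidHom.mem_ker, Subgroup.mem_center_iff, MulEquiv.ext_iff]
  refine forall_congr' fun g => ?_
  rw [MulAut.conj_apply, MulAut.one_apply, mul_inv_eq_iff_eq_mul, eq_comm]

theorem commutator_mul_central {G : Type*} [Group G] {z t : G} (hz : z ∈ Subgroup.center G)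
    (ht : t ∈ Subgroup.center G) (x y : G) : ⁅x * z, y * t⁆ = ⁅x, y⁆ := by
  rw [Subgroup.mem_center_iff] at hz ht
  have hz' : ∀ g, z * g = g * z := fun g => (hz g).symm
  have ht' : ∀ g, t * g = g * t := fun g => (ht g).symm
  rw [commutatorElement_def, commutatorElement_def, mul_inv_rev, mul_inv_rev]
  calc x * z * (y * t) * (z⁻¹ * x⁻¹) * (t⁻¹ * y⁻¹)
      = x * (z * (y * t)) * z⁻¹ * x⁻¹ * t⁻¹ * y⁻¹ := by group
    _ = x * y * (t * x⁻¹) * t⁻¹ * y⁻¹ := by rw [hz']; group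
    _ = x * y * x⁻¹ * y⁻¹ := by rw [ht']; group

/-- A subgroup that, together with central commutators, generates the group is everything. -/
theorem eq_top_of_forall_eq_mul_central {G : Type*} [Group G] {S : Subgroup G}
    (h : ∀ g, ∃ s ∈ S, ∃ z ∈ Subgroup.center G,
      z ∈ (⊤ : Subgroup G).lowerCentralSeries 1 ∧ g = s * z) : S = ⊤ := by
  have h1 : (⊤ : Subgroup G).lowerCentralSeries 1 ≤ S := by
    rw [Subgroup.lowerCentralSeries_succ, Subgroup.commutator_le]
    intro x _ y _
    obtain ⟨s, hs, z, hz, -, rfl⟩ := h x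
    obtain ⟨s', hs', z', hz', -, rfl⟩ := h y
    rw [commutator_mul_central hz hz', commutatorElement_def]
    exact mul_mem (mul_mem (mul_mem hs hs') (inv_mem hs)) (inv_mem hs')
  rw [eq_top_iff]
  intro g _
  obtain ⟨s, hs, z, -, hz, rfl⟩ := h g
  exact mul_mem hs (h1 hz)

/-- The family `f` freely generates `H` as a nilpotent group of class `c`. -/
def IsNilpotentFamily {G : Type*} [Group G] (c : ℕ) (H : Subgroup G) {ι : Type*} (f : ι → G) :
    Prop :=
  (FreeGroup.lift f).range = H ∧
    (FreeGroup.lift f).ker = (⊤ : Subgroup (FreeGroup ι)).lowerCentralSeries c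

namespace IsNilpotentFamily

variable {G : Type*} [Group G] {c : ℕ} {H : Subgroup G} {ι κ : Type*} {f : ι → G}

theorem comp_equiv (hf : IsNilpotentFamily c H f) (e : κ ≃ ι) :
    IsNilpotentFamily c H (f ∘ e) := by
  have h : FreeGroup.lift (f ∘ e) =
      (FreeGroup.lift f).comp (FreeGroup.freeGroupCongr e).toMonoidHom := by
    ext; simp
  constructor
  · rw [h, MonoidHom.range_comp, (MonoidHom.range_eq_top.2 (FreeGroup.freeGroupCongr e).surjective :
      (FreeGroup.freeGroupCongr e).toMonoidHom.range = ⊤), ← MonoidHom.range_eq_map, hf.1]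
  · rw [h, ← MonoidHom.comap_ker, hf.2]
    have := Subgroup.map_lowerCentralSeries (S := (⊤ : Subgroup (FreeGroup ι)))
      (FreeGroup.freeGroupCongr e).symm.toMonoidHom c
    rw [(Subgroup.map_top_of_surjective _ (FreeGroup.freeGroupCongr e).symm.surjective :
      (⊤ : Subgroup _).map (FreeGroup.freeGroupCongr e).symm.toMonoidHom = ⊤)] at this
    rw [← this]
    exact Subgroup.comap_equiv_eq_map_symm' _ _

theorem injective (hf : IsNilpotentFamily c H f) (hc : 1 ≤ c) : Function.Injective f := by
  classical
  intro i j hij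
  have h1 : FreeGroup.of i * (FreeGroup.of j)⁻¹ ∈ (FreeGroup.lift f).ker := by
    simp [MonoidHom.mem_ker, hij]
  rw [hf.2] at h1
  have h2 := Subgroup.lowerCentralSeries_antitone _ hc h1
  rw [Subgroup.top_lowerCentralSeries_one] at h2
  have h3 := Abelianization.commutator_subset_ker
    (FreeGroup.lift fun k => Multiplicative.ofAdd (if k = i then (1 : ℤ) else 0)) h2
  rw [MonoidHom.mem_ker] at h3
  by_contra hne
  simp [Ne.symm hne] at h3

theorem isNilpotentBasis_range (hf : IsNilpotentFamily c H f) (hinj : Function.Injective f) :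
    IsNilpotentBasis c H (Set.range f) := by
  have := hf.comp_equiv (Equiv.ofInjective f hinj).symm
  have h : f ∘ (Equiv.ofInjective f hinj).symm = Subtype.val := by
    funext x
    exact Equiv.apply_ofInjective_symm hinj x
  rwa [h] at this

section Top

variable (hf : IsNilpotentFamily c (⊤ : Subgroup G) f)
include hf

theorem surjective : Function.Surjective (FreeGroup.lift f) :=
  MonoidHom.range_eq_top.1 hf.1

theorem lift_eq_lift_iff {v w : FreeGroup ι} : FreeGroup.lift f v = FreeGroup.lift f w ↔
    v * w⁻¹ ∈ (⊤ : Subgroup (FreeGroup ι)).lowerCentralSeries c := by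
  rw [← hf.2, MonoidHom.mem_ker, map_mul, map_inv, mul_inv_eq_one]

theorem map_lowerCentralSeries (n : ℕ) :
    ((⊤ : Subgroup (FreeGroup ι)).lowerCentralSeries n).map (FreeGroup.lift f) =
      (⊤ : Subgroup G).lowerCentralSeries n := by
  rw [Subgroup.map_lowerCentralSeries, Subgroup.map_top_of_surjective _ hf.surjective]

theorem lowerCentralSeries_eq_bot : (⊤ : Subgroup G).lowerCentralSeries c = ⊥ := by
  rw [← hf.map_lowerCentralSeries, ← hf.2, Subgroup.map_eq_bot_iff]

theorem hom_ext {K : Type*} [Group K] {a b : G →* K} (h : ∀ i, a (f i) = b (f i)) : a = b := by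
  rw [← MonoidHom.cancel_right hf.surjective]
  ext i
  simpa using h i

theorem exists_hom {K : Type*} [Group K] (hK : (⊤ : Subgroup K).lowerCentralSeries c = ⊥)
    (g : ι → K) : ∃ a : G →* K, ∀ i, a (f i) = g i := by
  have hker : (FreeGroup.lift f).ker ≤ (FreeGroup.lift g).ker := by
    rw [hf.2, ← Subgroup.map_eq_bot_iff, Subgroup.map_lowerCentralSeries, eq_bot_iff, ← hK]
    exact Subgroup.lowerCentralSeries_mono c le_top
  refine ⟨(FreeGroup.lift f).liftOfSurjective hf.surjective ⟨FreeGroup.lift g, hker⟩, fun i => ?_⟩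
  have := (FreeGroup.lift f).liftOfRightInverse_comp_apply _
    (Function.rightInverse_surjInv hf.surjective) ⟨FreeGroup.lift g, hker⟩ (FreeGroup.of i)
  simpa using this

theorem exists_mulAut {f' : ι → G} (hf' : IsNilpotentFamily c (⊤ : Subgroup G) f') :
    ∃ θ : MulAut G, ∀ i, θ (f i) = f' i := by
  obtain ⟨a, ha⟩ := hf.exists_hom hf.lowerCentralSeries_eq_bot f'
  obtain ⟨b, hb⟩ := hf'.exists_hom hf.lowerCentralSeries_eq_bot f
  refine ⟨MonoidHom.toMulEquiv a b (hf.hom_ext fun i => ?_) (hf'.hom_ext fun i => ?_),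
    fun i => ?_⟩
  · simp [ha, hb]
  · simp [ha, hb]
  · simp [ha]

theorem mulAut_ext {a b : MulAut G} (h : ∀ i, a (f i) = b (f i)) : a = b :=
  MulEquiv.toMonoidHom_injective (hf.hom_ext h)

end Top

/-- The inclusion of the center in the last term is the Lie-theoretic fact that only scalars commute
with all letters, in the form `mem_lowerCentralSeries_of_commutator_mem`. -/
theorem center_eq {n : ℕ} [Nontrivial ι] (hf : IsNilpotentFamily (n + 1) (⊤ : Subgroup G) f) :
    Subgroup.center G = (⊤ : Subgroup G).lowerCentralSeries n := by
  apply le_antisymm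
  · intro z hz
    obtain ⟨w, rfl⟩ := hf.surjective z
    rw [← hf.map_lowerCentralSeries]
    refine Subgroup.mem_map_of_mem _ (mem_lowerCentralSeries_of_commutator_mem ι fun v => ?_)
    rw [← hf.2, MonoidHom.mem_ker, map_commutatorElement, commutatorElement_eq_one_iff_mul_comm]
    exact (Subgroup.mem_center_iff.1 hz _).symm
  · intro z hz
    rw [Subgroup.mem_center_iff]
    intro g
    have : ⁅z, g⁆ ∈ (⊤ : Subgroup G).lowerCentralSeries (n + 1) :=
      Subgroup.commutator_mem_commutator hz trivial
    rw [hf.lowerCentralSeries_eq_bot, Subgroup.mem_bot,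
      commutatorElement_eq_one_iff_mul_comm] at this
    exact this.symm

theorem conj {n : ℕ} [Nontrivial ι] (hf : IsNilpotentFamily (n + 1) (⊤ : Subgroup G) f) :
    IsNilpotentFamily n (innerAutomorphisms G) fun i => MulAut.conj (f i) := by
  have h : FreeGroup.lift (fun i => MulAut.conj (f i)) = MulAut.conj.comp (FreeGroup.lift f) := by
    ext1 i; simp
  constructor
  · rw [h, MonoidHom.range_comp, hf.1, ← MonoidHom.range_eq_map]
    rfl
  · rw [h, ← MonoidHom.comap_ker, ker_conj, hf.center_eq, ← hf.map_lowerCentralSeries,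
      Subgroup.comap_map_eq, hf.2, sup_eq_left]
    exact Subgroup.lowerCentralSeries_antitone _ (Nat.le_succ n)

theorem mk_eq {G ι : Type u} [Group G] [Infinite ι] {f : ι → G}
    (hf : IsNilpotentFamily c (⊤ : Subgroup G) f) (hc : 1 ≤ c) :
    Cardinal.mk ι = Cardinal.mk G := by
  apply le_antisymm (Cardinal.mk_le_of_injective (hf.injective hc))
  refine (Cardinal.mk_le_of_surjective hf.surjective).trans ?_
  rw [Cardinal.mk_freeGroup, max_eq_left (Cardinal.aleph0_le_mk ι)]

/-- Arbitrary preimages of a basis of the group of inner automorphisms form a basis. -/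
theorem of_conj {n : ℕ} (hn : 1 ≤ n) {κ : Type*} [Nontrivial κ] {b : κ → G}
    (hb : IsNilpotentFamily (n + 1) (⊤ : Subgroup G) b)
    (hf : IsNilpotentFamily n (innerAutomorphisms G) fun i => MulAut.conj (f i)) :
    IsNilpotentFamily (n + 1) (⊤ : Subgroup G) f := by
  have h : FreeGroup.lift (fun i => MulAut.conj (f i)) = MulAut.conj.comp (FreeGroup.lift f) := by
    ext1 i; simp
  have hrange : (FreeGroup.lift f).range = ⊤ := by
    -- The preimages generate modulo the center, which consists of products of commutators since `1
    -- ≤ n`.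
    apply eq_top_of_forall_eq_mul_central
    intro g
    have hg : MulAut.conj g ∈ (FreeGroup.lift fun i => MulAut.conj (f i)).range :=
      hf.1 ▸ ⟨g, rfl⟩
    obtain ⟨w, hw⟩ := hg
    rw [h, MonoidHom.comp_apply] at hw
    have hz : (FreeGroup.lift f w)⁻¹ * g ∈ Subgroup.center G := by
      rw [← ker_conj, MonoidHom.mem_ker, map_mul, map_inv, hw, inv_mul_cancel]
    refine ⟨_, ⟨w, rfl⟩, _, hz, ?_, (mul_inv_cancel_left _ _).symm⟩
    rw [hb.center_eq] at hz
    exact Subgroup.lowerCentralSeries_antitone _ hn hz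
  refine ⟨hrange, le_antisymm ?_ ?_⟩
  swap
  · rw [← Subgroup.map_eq_bot_iff, Subgroup.map_lowerCentralSeries, eq_bot_iff,
      ← hb.lowerCentralSeries_eq_bot]
    exact Subgroup.lowerCentralSeries_mono _ le_top
  set N := (⊤ : Subgroup (FreeGroup ι)).lowerCentralSeries (n + 1) with hN
  have hbot : (⊤ : Subgroup (FreeGroup ι ⧸ N)).lowerCentralSeries (n + 1) = ⊥ := by
    rw [← Subgroup.map_top_of_surjective _ (QuotientGroup.mk'_surjective N),
      ← Subgroup.map_lowerCentralSeries, Subgroup.map_eq_bot_iff, QuotientGroup.ker_mk']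
  choose w hw using fun k => MonoidHom.range_eq_top.1 hrange (b k)
  -- Freeness of `G` gives a section `s` of the projection `p` from the free nilpotent group on `ι`.
  -- Once `s` is surjective, `p` is injective and the kernel is as small as claimed.
  obtain ⟨s, hs⟩ := hb.exists_hom hbot fun k => QuotientGroup.mk' N (w k)
  have hker : N ≤ (FreeGroup.lift f).ker := by
    rw [← Subgroup.map_eq_bot_iff, Subgroup.map_lowerCentralSeries, eq_bot_iff,
      ← hb.lowerCentralSeries_eq_bot]
    exact Subgroup.lowerCentralSeries_mono _ le_top
  set p : FreeGroup ι ⧸ N →* G := QuotientGroup.lift N (FreeGroup.lift f) hker with hp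
  have hps : ∀ g, p (s g) = g := by
    have : p.comp s = MonoidHom.id G := hb.hom_ext fun k => by
      rw [MonoidHom.comp_apply, hs, MonoidHom.id_apply]
      exact hw k
    exact fun g => DFunLike.congr_fun this g
  have s_range : s.range = ⊤ := by
    apply eq_top_of_forall_eq_mul_central
    intro m
    refine ⟨s (p m), ⟨_, rfl⟩, (s (p m))⁻¹ * m, ?_⟩
    obtain ⟨v, hv⟩ := QuotientGroup.mk'_surjective N ((s (p m))⁻¹ * m)
    have h1 : FreeGroup.lift f v = 1 := by
      have : p (QuotientGroup.mk' N v) = 1 := by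
        rw [hv, map_mul, map_inv, hps, inv_mul_cancel]
      exact this
    -- The kernel of `p` acts trivially by conjugation, so freeness of the conjugations puts it in
    -- the last term, which is central. Hence the range of `s` is everything.
    have h2 : v ∈ (⊤ : Subgroup (FreeGroup ι)).lowerCentralSeries n := by
      rw [← hf.2, h, MonoidHom.mem_ker, MonoidHom.comp_apply, h1, map_one]
    have h3 : QuotientGroup.mk' N v ∈ (⊤ : Subgroup (FreeGroup ι ⧸ N)).lowerCentralSeries n := by
      rw [← Subgroup.map_top_of_surjective _ (QuotientGroup.mk'_surjective N),
        ← Subgroup.map_lowerCentralSeries]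
      exact Subgroup.mem_map_of_mem _ h2
    rw [hv] at h3
    refine ⟨?_, Subgroup.lowerCentralSeries_antitone _ hn h3, (mul_inv_cancel_left _ _).symm⟩
    rw [Subgroup.mem_center_iff]
    intro g
    have : ⁅(s (p m))⁻¹ * m, g⁆ ∈ (⊤ : Subgroup (FreeGroup ι ⧸ N)).lowerCentralSeries (n + 1) :=
      Subgroup.commutator_mem_commutator h3 trivial
    rw [hbot, Subgroup.mem_bot, commutatorElement_eq_one_iff_mul_comm] at this
    exact this.symm
  intro v hv
  obtain ⟨g, hg⟩ := MonoidHom.range_eq_top.1 s_range (QuotientGroup.mk' N v)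
  have h1 : g = 1 := by
    rw [← hps g, hg]
    exact hv
  rw [h1, map_one] at hg
  exact (QuotientGroup.eq_one_iff v).1 hg.symm

end IsNilpotentFamily

/-- Homomorphisms that agree modulo the center agree on the commutator subgroup. -/
theorem eq_of_conj_comp_eq {F G : Type*} [Group F] [Group G] {a b : F →* G}
    (h : (MulAut.conj : G →* MulAut G).comp a = MulAut.conj.comp b) {w : F}
    (hw : w ∈ (⊤ : Subgroup F).lowerCentralSeries 1) : a w = b w := by
  have : (⊤ : Subgroup F).lowerCentralSeries 1 ≤ a.eqLocus b := by
    rw [Subgroup.lowerCentralSeries_succ, Subgroup.commutator_le]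
    intro x _ y _
    have h1 : ∀ x, ∃ z ∈ Subgroup.center G, b x = a x * z := fun x =>
      ⟨(a x)⁻¹ * b x, by
        rw [← ker_conj, MonoidHom.mem_ker, map_mul, map_inv]
        have := DFunLike.congr_fun h x
        simp only [MonoidHom.comp_apply] at this
        rw [this, inv_mul_cancel], (mul_inv_cancel_left _ _).symm⟩
    obtain ⟨z, hz, hx⟩ := h1 x
    obtain ⟨t, ht, hy⟩ := h1 y
    change a ⁅x, y⁆ = b ⁅x, y⁆
    rw [map_commutatorElement, map_commutatorElement, hx, hy, commutator_mul_central hz ht]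
  exact this hw

end NilpotentFamilies

/-! ### A fixed preimage of the fixed conjugation -/

section FixedLift

/-- The action of permutations of the letters on words. -/
def wordPerm (ι : Type*) : Equiv.Perm ι →* Equiv.Perm (FreeMonoid ι) :=
  MonoidHom.toHomPerm
    { toFun := fun σ w => FreeMonoid.map σ w
      map_one' := by funext w; exact DFunLike.congr_fun FreeMonoid.map_id w
      map_mul' := fun σ τ => by funext w; exact DFunLike.congr_fun (FreeMonoid.map_comp σ τ) w }

/-- The action of permutations of the letters on multisets of letters. -/
def multisetPerm (ι : Type*) : Equiv.Perm ι →* Equiv.Perm (Multiset ι) :=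
  MonoidHom.toHomPerm
    { toFun := fun σ => Multiset.map σ
      map_one' := by funext w; exact Multiset.map_id w
      map_mul' := fun σ τ => by funext w; exact (Multiset.map_map σ τ w).symm }

theorem coe_wordPerm {ι : Type*} (σ : Equiv.Perm ι) :
    (wordPerm ι σ : FreeMonoid ι → FreeMonoid ι) = FreeMonoid.map σ := rfl

theorem multisetPerm_apply {ι : Type*} (σ : Equiv.Perm ι) (α : Multiset ι) :
    multisetPerm ι σ α = α.map σ := rfl

theorem wordLetters_wordPerm {ι : Type*} (σ : Equiv.Perm ι) (w : FreeMonoid ι) :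
    wordLetters (wordPerm ι σ w) = multisetPerm ι σ (wordLetters w) := by
  rw [coe_wordPerm, multisetPerm_apply]
  simp [wordLetters, FreeMonoid.toList_map]

/-- A multiset invariant under $\sigma^k$ contains the whole forward $\sigma^k$-orbit of each of its
letters, but has only finitely many letters. -/
theorem eq_zero_of_multisetPerm_zpow {ι : Type*} {σ : Equiv.Perm ι} {α : Multiset ι} {y : ι}
    (hy : y ∈ α) (hfree : ∀ k : ℤ, (σ ^ k) y = y → k = 0) {k : ℤ}
    (hk : (multisetPerm ι σ ^ k) α = α) : k = 0 := by
  classical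
  by_contra hk0
  have h1 : ∀ j : ℕ, ((σ ^ k) ^ j) y ∈ α := by
    intro j
    induction j with
    | zero => simpa using hy
    | succ j ih =>
      rw [← map_zpow, multisetPerm_apply] at hk
      rw [pow_succ', Equiv.Perm.mul_apply, ← hk]
      exact Multiset.mem_map_of_mem _ ih
  have h2 : Function.Injective fun j : ℕ => ((σ ^ k) ^ j) y := by
    intro i j hij
    simp only [← zpow_natCast, ← zpow_mul] at hij
    have := injective_zpow_apply hfree hij
    have := mul_left_cancel₀ hk0 this
    exact_mod_cast this
  refine Set.infinite_range_of_injective h2 (α.toFinset.finite_toSet.subset ?_)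
  rintro _ ⟨j, rfl⟩
  simpa using h1 j

variable {G ι : Type*} [Group G] {n : ℕ} {f : ι → G}

theorem lift_eq_lift_iff_lieTerm (hf : IsNilpotentFamily (n + 1) (⊤ : Subgroup G) f)
    {v w : FreeGroup ι}
    (hv : v ∈ (⊤ : Subgroup (FreeGroup ι)).lowerCentralSeries n)
    (hw : w ∈ (⊤ : Subgroup (FreeGroup ι)).lowerCentralSeries n) :
    FreeGroup.lift f v = FreeGroup.lift f w ↔ lieTerm ℚ n v = lieTerm ℚ n w := by
  rw [hf.lift_eq_lift_iff, ← lieTerm_eq_zero_iff (R := ℚ) (mul_mem hv (inv_mem hw)),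
    lieTerm_mul hv (inv_mem hw), lieTerm_inv hw, ← sub_eq_add_neg, sub_eq_zero]

theorem map_mem_lowerCentralSeries {F K : Type*} [Group F] [Group K] (a : F →* K) {w : F}
    (hw : w ∈ (⊤ : Subgroup F).lowerCentralSeries n) :
    a w ∈ (⊤ : Subgroup K).lowerCentralSeries n := by
  have := Subgroup.mem_map_of_mem a hw
  rw [Subgroup.map_lowerCentralSeries] at this
  exact Subgroup.lowerCentralSeries_mono n le_top this

/-- An automorphism that permutes a basis modulo the center acts on the last term of the lower
central series by permuting letters. -/
theorem apply_lift_of_mem_lowerCentralSeries (f : ι → G) {π : MulAut G} {σ : ι → ι}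
    (hπ : ∀ i, MulAut.conj (π (f i)) = MulAut.conj (f (σ i))) {w : FreeGroup ι}
    (hw : w ∈ (⊤ : Subgroup (FreeGroup ι)).lowerCentralSeries (n + 1)) :
    π (FreeGroup.lift f w) = FreeGroup.lift f (FreeGroup.map σ w) := by
  refine eq_of_conj_comp_eq (a := π.toMonoidHom.comp (FreeGroup.lift f))
    (b := (FreeGroup.lift f).comp (FreeGroup.map σ)) ?_
    (Subgroup.lowerCentralSeries_antitone _ (Nat.le_add_left 1 n) hw)
  ext1 i
  simpa using hπ i

/-- The defect of `f i₀` from being fixed is a Lie polynomial `u` of degree `n + 2`; correcting the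
lift by a central element changes `u` by a coboundary. The roots make the orbit sums of `u` vanish,
hence `u` is itself a coboundary. -/
theorem exists_fixed_lift [Nontrivial ι] (hf : IsNilpotentFamily (n + 2) (⊤ : Subgroup G) f)
    {π : MulAut G} {σ : Equiv.Perm ι} (hπ : ∀ i, MulAut.conj (π (f i)) = MulAut.conj (f (σ i)))
    {i₀ : ι} (hi₀ : σ i₀ = i₀) (hfree : ∀ i, i ≠ i₀ → ∀ k : ℤ, (σ ^ k) i = i → k = 0)
    (hroot : ∀ m : ℕ, 2 ≤ m → ∃ (ρ : MulAut G) (r : Equiv.Perm ι),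
      (∀ i, MulAut.conj (ρ (f i)) = MulAut.conj (f (r i))) ∧ ρ ^ m = π ∧ r ^ m = σ ∧ r i₀ = i₀) :
    ∃ x, MulAut.conj x = MulAut.conj (f i₀) ∧ π x = x := by
  have hcent : ∀ g h : G, MulAut.conj g = MulAut.conj h →
      ∃ w ∈ (⊤ : Subgroup (FreeGroup ι)).lowerCentralSeries (n + 1),
        g = h * FreeGroup.lift f w := by
    intro g h hgh
    have : h⁻¹ * g ∈ Subgroup.center G := by
      rw [← ker_conj, MonoidHom.mem_ker, map_mul, map_inv, hgh, inv_mul_cancel]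
    rw [hf.center_eq, ← hf.map_lowerCentralSeries] at this
    obtain ⟨w, hw, h1⟩ := this
    exact ⟨w, hw, by rw [h1, mul_inv_cancel_left]⟩
  have hcomm : ∀ w ∈ (⊤ : Subgroup (FreeGroup ι)).lowerCentralSeries (n + 1), ∀ g,
      g * FreeGroup.lift f w = FreeGroup.lift f w * g := by
    intro w hw
    have := map_mem_lowerCentralSeries (FreeGroup.lift f) hw
    rw [← hf.center_eq] at this
    exact Subgroup.mem_center_iff.1 this
  obtain ⟨w, hw, hz⟩ := hcent (π (f i₀)) (f i₀) (by rw [hπ, hi₀])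
  set B := FreeAlgebra.basisFreeMonoid ℚ ι with hB
  set u : FreeMonoid ι →₀ ℚ := B.repr (lieTerm ℚ (n + 1) w) with hu
  have hmap : ∀ (τ : Equiv.Perm ι) (v : FreeGroup ι),
      B.repr (lieTerm ℚ (n + 1) (FreeGroup.map τ v)) =
        Finsupp.mapDomain (wordPerm ι τ) (B.repr (lieTerm ℚ (n + 1) v)) :=
    fun τ v => repr_lieTerm_map (R := ℚ) τ (n + 1) v
  have huL : u ∈ lieCoeffs ℚ ι (n + 1) := mem_lieCoeffs.2 ⟨w, hw, rfl⟩
  have hpfree : ∀ v : FreeMonoid ι, (∀ k : ℤ,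
      (multisetPerm ι σ ^ k) (wordLetters v) = wordLetters v → k = 0) →
      ∀ k : ℤ, (wordPerm ι σ ^ k) v = v → k = 0 := by
    intro v hv k hk
    apply hv
    rw [← map_zpow] at hk ⊢
    rw [← wordLetters_wordPerm, hk]
  have hcob : ∃ v ∈ lieCoeffs ℚ ι (n + 1), u = Finsupp.mapDomain (wordPerm ι σ) v - v := by
    refine exists_eq_coboundary (d := wordLetters) (q := multisetPerm ι σ)
      (wordLetters_wordPerm σ) ?_ (fun g hg α => ?_) huL ?_ ?_
    · intro k g hg
      obtain ⟨v, hv, rfl⟩ := mem_lieCoeffs.1 hg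
      rw [← map_zpow, ← hmap]
      exact mem_lieCoeffs.2 ⟨_, map_mem_lowerCentralSeries _ hv, rfl⟩
    · convert filter_mem_lieCoeffs hg α
      rfl
    · intro v hv k hk
      -- The degree is at least two, so a word that occurs in `u` has a letter other than `i₀`,
      -- whose orbit is infinite.
      obtain ⟨y, hy, hyi⟩ := exists_ne_of_mem_lieCoeffs huL hv i₀
      exact eq_zero_of_multisetPerm_zpow hy (hfree y hyi) hk
    · intro v hv
      refine finsum_orbit_eq_zero ?_ (hpfree v hv)
      intro m hm
      obtain ⟨ρ, r, hρ, hρm, hrm, hr⟩ := hroot m hm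
      refine ⟨wordPerm ι r, by rw [← map_pow, hrm], ?_⟩
      obtain ⟨wm, hwm, hzm⟩ := hcent (ρ (f i₀)) (f i₀) (by rw [hρ, hr])
      refine ⟨B.repr (lieTerm ℚ (n + 1) wm), ?_⟩
      have hmr := map_mem_lowerCentralSeries (FreeGroup.map r) hw
      have hms := map_mem_lowerCentralSeries (FreeGroup.map σ) hwm
      rw [hu, ← hmap, ← hmap, ← map_add, ← map_add, ← lieTerm_mul hwm hmr,
        ← lieTerm_mul hw hms]
      congr 1
      rw [← lift_eq_lift_iff_lieTerm hf (mul_mem hwm hmr) (mul_mem hw hms), map_mul, map_mul,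
        ← apply_lift_of_mem_lowerCentralSeries f hρ hw,
        ← apply_lift_of_mem_lowerCentralSeries f hπ hwm]
      -- As a power of `ρ`, `π` commutes with it; comparing central factors on both sides gives the
      -- relation between `u` and the defect of `ρ`.
      have hcom : ρ (π (f i₀)) = π (ρ (f i₀)) := by
        rw [← hρm, ← MulAut.mul_apply, ← MulAut.mul_apply, ← pow_succ', ← pow_succ]
      rw [hz, hzm, map_mul, map_mul, hz, hzm, mul_assoc, mul_assoc] at hcom
      exact mul_left_cancel hcom
  obtain ⟨_, hvL, huv⟩ := hcob
  obtain ⟨v, hv, rfl⟩ := mem_lieCoeffs.1 hvL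
  have hms := map_mem_lowerCentralSeries (FreeGroup.map σ) hv
  have h1 : FreeGroup.lift f (w * v) = FreeGroup.lift f (FreeGroup.map σ v) := by
    rw [lift_eq_lift_iff_lieTerm hf (mul_mem hw hv) hms, lieTerm_mul hw hv]
    apply B.repr.injective
    rw [map_add, hmap, ← hu, huv]
    exact sub_add_cancel _ _
  -- With $z$ and $v$ also denoting their images, $\pi(v)=zv$, so
  -- $\pi(xv^{-1})=xz(zv)^{-1}=xv^{-1}$.
  refine ⟨f i₀ * (FreeGroup.lift f v)⁻¹, ?_, ?_⟩
  · have : (FreeGroup.lift f v)⁻¹ ∈ Subgroup.center G := by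
      rw [hf.center_eq]
      exact inv_mem (map_mem_lowerCentralSeries _ hv)
    rw [← ker_conj, MonoidHom.mem_ker] at this
    rw [map_mul, this, mul_one]
  · rw [map_mul, map_inv, apply_lift_of_mem_lowerCentralSeries f hπ hv, ← h1, hz, map_mul,
      ← hcomm w hw (FreeGroup.lift f v)]
    group

end FixedLift

/-! ### Permutations with one fixed point and infinitely many infinite orbits -/

section ShiftPermutations

/-- The permutation `s` has exactly one fixed point `y₀`, all other orbits are infinite, and there
are infinitely many of them. -/
structure IsShiftPerm {Y : Type*} (s : Equiv.Perm Y) (y₀ : Y) : Prop where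
  fixed : s y₀ = y₀
  free : ∀ y, y ≠ y₀ → ∀ k : ℤ, (s ^ k) y = y → k = 0
  infinite : {O : Set Y | ∃ y, y ≠ y₀ ∧ O = Set.range fun k : ℤ => (s ^ k) y}.Infinite

theorem IsShiftPerm.infinite_type {Y : Type*} {s : Equiv.Perm Y} {y₀ : Y}
    (h : IsShiftPerm s y₀) : Infinite Y := by
  by_contra hY
  rw [not_infinite_iff_finite] at hY
  exact h.infinite (Set.toFinite _)

theorem IsShiftPerm.exists_equiv {Y : Type u} {s : Equiv.Perm Y} {y₀ : Y} (h : IsShiftPerm s y₀) :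
    ∃ (I : Type u) (e : Y ≃ Option (I × ℤ)), Infinite I ∧ e y₀ = none ∧
      ∀ i k, s (e.symm (some (i, k))) = e.symm (some (i, k + 1)) := by
  classical
  let S := Equiv.Perm.SameCycle.setoid s
  let I := {q : Quotient S // q ≠ Quotient.mk S y₀}
  have hfix : ∀ k : ℤ, (s ^ k) y₀ = y₀ :=
    fun k => Equiv.Perm.zpow_apply_eq_self_of_apply_eq_self h.fixed k
  have hmk : ∀ (y : Y) (k : ℤ), Quotient.mk S ((s ^ k) y) = Quotient.mk S y :=
    fun y k => Quotient.sound (show s.SameCycle _ _ from ⟨-k, by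
      rw [← Equiv.Perm.mul_apply, ← zpow_add, neg_add_cancel, zpow_zero, Equiv.Perm.one_apply]⟩)
  have hout : ∀ i : I, i.1.out ≠ y₀ := by
    intro i hi
    exact i.2 ((Quotient.out_eq i.1).symm.trans (congrArg _ hi))
  let g : Option (I × ℤ) → Y := fun o => o.elim y₀ fun p => (s ^ p.2) p.1.1.out
  have hg : Function.Bijective g := by
    constructor
    · have hne : ∀ p : I × ℤ, (s ^ p.2) p.1.1.out ≠ y₀ := by
        intro p hp
        exact hout p.1 ((s ^ p.2).injective (hp.trans (hfix p.2).symm))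
      rintro (_ | ⟨i, k⟩) (_ | ⟨j, l⟩) hij
      · rfl
      · exact absurd hij.symm (hne (j, l))
      · exact absurd hij (hne (i, k))
      · have hij' : (s ^ k) i.1.out = (s ^ l) j.1.out := hij
        have h1 : i = j := by
          apply Subtype.ext
          rw [← Quotient.out_eq i.1, ← Quotient.out_eq j.1, ← hmk _ k, ← hmk j.1.out l, hij']
        subst h1
        rw [injective_zpow_apply (h.free _ (hout i)) hij']
    · intro y
      by_cases hy : y = y₀
      · exact ⟨none, hy.symm⟩
      · have h1 : s.SameCycle (Quotient.mk S y).out y := Quotient.exact (Quotient.out_eq (Quotient.mk S y))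
        obtain ⟨k, hk⟩ := h1
        refine ⟨some (⟨Quotient.mk S y, fun h2 => hy ?_⟩, k), hk⟩
        obtain ⟨l, hl⟩ : s.SameCycle y y₀ := Quotient.exact h2
        rw [← hfix l] at hl
        exact (s ^ l).injective hl
  refine ⟨I, (Equiv.ofBijective g hg).symm, ?_, ?_, ?_⟩
  · by_contra hI
    rw [not_infinite_iff_finite] at hI
    apply h.infinite
    refine (Set.finite_range fun i : I => Set.range fun k : ℤ => (s ^ k) i.1.out).subset ?_
    rintro _ ⟨y, hy, rfl⟩
    obtain ⟨o, ho⟩ := hg.2 y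
    rcases o with _ | ⟨i, l⟩
    · exact absurd ho.symm hy
    · refine ⟨i, ?_⟩
      have ho' : (s ^ l) i.1.out = y := ho
      rw [← ho']
      ext z
      constructor
      · rintro ⟨k, rfl⟩
        exact ⟨k - l, by simp only; rw [← Equiv.Perm.mul_apply, ← zpow_add, sub_add_cancel]⟩
      · rintro ⟨k, rfl⟩
        exact ⟨k + l, by simp only; rw [← Equiv.Perm.mul_apply, ← zpow_add]⟩
  · rw [Equiv.symm_apply_eq]
    rfl
  · intro i k
    rw [Equiv.symm_symm]
    change s ((s ^ k) i.1.out) = (s ^ (k + 1)) i.1.out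
    rw [add_comm, zpow_add, zpow_one, Equiv.Perm.mul_apply]

/-- The number of infinite orbits is an infinite cardinal, so it equals the cardinality of the whole
set; equal cardinalities therefore give equal orbit types. -/
theorem IsShiftPerm.exists_conj {Y Z : Type u} {s : Equiv.Perm Y} {y₀ : Y} (h : IsShiftPerm s y₀)
    {t : Equiv.Perm Z} {z₀ : Z} (h' : IsShiftPerm t z₀) (hYZ : Cardinal.mk Y = Cardinal.mk Z) :
    ∃ e : Y ≃ Z, ∀ y, e (s y) = t (e y) := by
  obtain ⟨I, e, hI, he, hs⟩ := h.exists_equiv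
  obtain ⟨J, e', hJ, he', ht⟩ := h'.exists_equiv
  have hcard : ∀ (I : Type u) [Infinite I], Cardinal.mk (Option (I × ℤ)) = Cardinal.mk I := by
    intro I _
    rw [Cardinal.mk_option]
    have hω := Cardinal.aleph0_le_mk I
    have : Cardinal.mk (I × ℤ) = Cardinal.mk I := by
      rw [Cardinal.mk_prod, Cardinal.lift_uzero, Cardinal.mk_denumerable ℤ, Cardinal.lift_aleph0,
        Cardinal.mul_aleph0_eq hω]
    rw [this, Cardinal.add_one_eq hω]
  have hIJ : Cardinal.mk I = Cardinal.mk J := by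
    rw [← hcard I, ← hcard J, ← Cardinal.mk_congr e, ← Cardinal.mk_congr e', hYZ]
  obtain ⟨b⟩ := Cardinal.eq.1 hIJ
  refine ⟨e.trans ((Equiv.optionCongr (b.prodCongr (Equiv.refl ℤ))).trans e'.symm), fun y => ?_⟩
  obtain ⟨o, rfl⟩ := e.symm.surjective y
  rcases o with _ | ⟨i, k⟩
  · have h1 : e.symm none = y₀ := by rw [← he, Equiv.symm_apply_apply]
    have h2 : e'.symm none = z₀ := by rw [← he', Equiv.symm_apply_apply]
    rw [h1, h.fixed]
    simp [he, h2, h'.fixed]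
  · rw [hs]
    simp [ht]

/-- Translation of the second coordinate. -/
def optionShift (I : Type*) {A : Type*} [AddGroup A] (a : A) : Equiv.Perm (Option (I × A)) :=
  Equiv.optionCongr ((Equiv.refl I).prodCongr (Equiv.addRight a))

theorem optionShift_some {I A : Type*} [AddGroup A] (a : A) (i : I) (b : A) :
    optionShift I a (some (i, b)) = some (i, b + a) := rfl

theorem optionShift_pow {I A : Type*} [AddGroup A] (a : A) (k : ℕ) :
    optionShift I a ^ k = optionShift I (k • a) := by
  induction k with
  | zero =>
    ext1 o
    rcases o with _ | ⟨i, b⟩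
    · rfl
    · simp [optionShift_some]
  | succ k ih =>
    ext1 o
    rw [pow_succ, Equiv.Perm.mul_apply, ih]
    rcases o with _ | ⟨i, b⟩
    · rfl
    · rw [optionShift_some, optionShift_some, optionShift_some, add_assoc, succ_nsmul']

theorem optionShift_inv {I A : Type*} [AddGroup A] (a : A) :
    (optionShift I a)⁻¹ = optionShift I (-a) := by
  rw [inv_eq_iff_mul_eq_one]
  ext1 o
  rcases o with _ | ⟨i, b⟩
  · rfl
  · simp [optionShift_some]

theorem optionShift_zpow {I A : Type*} [AddGroup A] (a : A) (k : ℤ) :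
    optionShift I a ^ k = optionShift I (k • a) := by
  obtain ⟨k, rfl | rfl⟩ := k.eq_nat_or_neg
  · rw [zpow_natCast, optionShift_pow, natCast_zsmul]
  · rw [zpow_neg, zpow_natCast, optionShift_pow, optionShift_inv, neg_zsmul, natCast_zsmul]

/-- Rational rather than integral coordinates are used because $\mathbb Q$ is a divisible ordered
group: translation by $1$ has translations as roots of every degree. -/
theorem isShiftPerm_optionShift (I : Type*) [Infinite I] :
    IsShiftPerm (optionShift I (1 : ℚ)) none where
  fixed := rfl
  free := by
    rintro (_ | ⟨i, q⟩) hy k hk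
    · exact absurd rfl hy
    · rw [optionShift_zpow, optionShift_some] at hk
      simpa using hk
  infinite := by
    have : Function.Injective fun i : I => Set.range fun k : ℤ =>
        (optionShift I (1 : ℚ) ^ k) (some (i, 0)) := by
      intro i j hij
      have h1 : some (i, (0 : ℚ)) ∈ Set.range fun k : ℤ =>
          (optionShift I (1 : ℚ) ^ k) (some (i, 0)) := ⟨0, rfl⟩
      simp only at hij
      rw [hij] at h1
      obtain ⟨k, hk⟩ := h1
      simp only at hk
      rw [optionShift_zpow, optionShift_some] at hk
      simp at hk
      exact hk.1.symm
    refine (Set.infinite_range_of_injective this).mono ?_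
    rintro _ ⟨i, rfl⟩
    exact ⟨_, Option.some_ne_none _, rfl⟩

end ShiftPermutations

/-! ### Automorphisms that permute a basis, and invariant orders -/

section PermutationalAutomorphisms

theorem conj_apply_eq {G : Type*} [Group G] (φ : MulAut G) (a : G) :
    MulAut.conj (φ a) = MulAut.conj φ (MulAut.conj a) := by
  ext z
  simp [MulAut.conj_apply, MulAut.mul_apply]

/-- The permutation of an invariant set induced by an automorphism. -/
def imagePerm {G : Type*} [Group G] (f : MulAut G) {X : Set G} (h : f '' X = X) :
    Equiv.Perm X :=
  Equiv.Perm.subtypePerm (p := (· ∈ X)) f.toEquiv fun x => by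
    constructor
    · intro hx
      rw [← h] at hx
      obtain ⟨y, hy, hyx⟩ := hx
      rwa [← f.injective hyx]
    · intro hx
      rw [← h]
      exact ⟨x, hx, rfl⟩

theorem coe_imagePerm {G : Type*} [Group G] (f : MulAut G) {X : Set G} (h : f '' X = X) (x : X) :
    (imagePerm f h x : G) = f x := rfl

theorem coe_imagePerm_zpow {G : Type*} [Group G] (f : MulAut G) {X : Set G} (h : f '' X = X)
    (k : ℤ) (x : X) : ((imagePerm f h ^ k) x : G) = (f ^ k) x := by
  induction k generalizing x with
  | zero => rfl
  | succ i ih =>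
    rw [zpow_add_one, Equiv.Perm.mul_apply, ih, coe_imagePerm, zpow_add_one, MulAut.mul_apply]
  | pred i ih =>
    obtain ⟨y, rfl⟩ := (imagePerm f h).surjective x
    rw [zpow_sub_one, Equiv.Perm.mul_apply, Equiv.Perm.inv_def, Equiv.symm_apply_apply, ih,
      coe_imagePerm, zpow_sub_one, MulAut.mul_apply, MulAut.inv_apply_self]

theorem eq_zero_of_infinite_orbitOf {G : Type*} [Group G] {f : MulAut G} {z : G}
    (h : (orbitOf f z).Infinite) {k : ℤ} (hk : (f ^ k) z = z) : k = 0 := by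
  by_contra hk0
  apply h
  have h1 : ∀ m : ℤ, ((f ^ k) ^ m) z = z := by
    intro m
    have := Equiv.Perm.zpow_apply_eq_self_of_apply_eq_self (f := MulAut.toPerm G (f ^ k)) hk m
    rwa [← map_zpow] at this
  refine ((Set.finite_Ico 0 |k|).image fun j : ℤ => (f ^ j) z).subset ?_
  rintro _ ⟨j, rfl⟩
  refine ⟨j % k, ⟨Int.emod_nonneg j hk0, Int.emod_lt_abs j hk0⟩, ?_⟩
  simp only
  conv_rhs => rw [← Int.emod_add_mul_ediv j k, zpow_add, zpow_mul, MulAut.mul_apply, h1]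

theorem isShiftPerm_imagePerm {G : Type*} [Group G] {f : MulAut G} {X : Set G} (h : f '' X = X)
    {x : X} (hx : f x = x) (hfree : ∀ y : X, y ≠ x → ∀ k : ℤ, (f ^ k) (y : G) = y → k = 0)
    {S : Set (Set G)} (hS : S.Infinite)
    (hSX : ∀ O ∈ S, ∃ y ∈ X \ {(x : G)}, O = orbitOf f y) : IsShiftPerm (imagePerm f h) x where
  fixed := Subtype.ext hx
  free := fun y hy k hk => hfree y hy k (by rw [← coe_imagePerm_zpow f h, hk])
  infinite := by
    intro hfin
    apply hS
    refine (hfin.image fun O => Subtype.val '' O).subset ?_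
    intro O hO
    obtain ⟨y, ⟨hy, hyx⟩, rfl⟩ := hSX O hO
    refine ⟨_, ⟨⟨y, hy⟩, fun h => hyx (congrArg Subtype.val h), rfl⟩, ?_⟩
    simp only [orbitOf, ← Set.range_comp]
    congr 1
    funext k
    exact coe_imagePerm_zpow f h k _

theorem IsPiStar.exists_isShiftPerm {N : Type*} [Group N] {c : ℕ} {f : MulAut N}
    (hf : IsPiStar c f) : ∃ (X : Set N) (s : Equiv.Perm X) (x : X),
      IsNilpotentFamily c (⊤ : Subgroup N) (Subtype.val : X → N) ∧ IsShiftPerm s x ∧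
        ∀ y : X, f y = s y := by
  obtain ⟨X, hX, hfX, x, hx, hfx, hfree, hinf⟩ := hf
  refine ⟨X, imagePerm f hfX, ⟨x, hx⟩, hX, isShiftPerm_imagePerm hfX hfx ?_ hinf ?_, fun y => rfl⟩
  · intro y hy k hk
    exact eq_zero_of_infinite_orbitOf (hfree y ⟨y.2, fun h => hy (Subtype.ext h)⟩) hk
  · rintro _ ⟨y, hy, rfl⟩
    exact ⟨y, hy, rfl⟩

theorem IsNilpotentFamily.map_mulAut {N ι : Type*} [Group N] {c : ℕ} {f : ι → N}
    (hf : IsNilpotentFamily c (⊤ : Subgroup N) f) (θ : MulAut N) :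
    IsNilpotentFamily c (⊤ : Subgroup N) (θ ∘ f) := by
  have h : FreeGroup.lift (θ ∘ f) = θ.toMonoidHom.comp (FreeGroup.lift f) := by
    ext1 i; simp
  constructor
  · rw [h, MonoidHom.range_comp, hf.1]
    exact Subgroup.map_top_of_surjective _ θ.surjective
  · rw [← hf.2, h]
    ext w
    simp [MonoidHom.mem_ker]

/-- Coordinates on a basis for a conjugate of `πstar`. -/
theorem exists_rational_coordinates {N : Type u} [Group N] {c : ℕ} {πstar π : MulAut N}
    (hstar : IsPiStar c πstar) (hconj : IsConj πstar π) :
    ∃ (I : Type u) (f : Option (I × ℚ) → N), Infinite I ∧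
      IsNilpotentFamily c (⊤ : Subgroup N) f ∧ ∀ o, π (f o) = f (optionShift I 1 o) := by
  obtain ⟨X, s, x, hX, hs, hsf⟩ := hstar.exists_isShiftPerm
  have := hs.infinite_type
  have hcard : Cardinal.mk X = Cardinal.mk (Option (X × ℚ)) := by
    have hω := Cardinal.aleph0_le_mk X
    rw [Cardinal.mk_option, Cardinal.mk_prod, Cardinal.lift_uzero, Cardinal.mk_denumerable ℚ,
      Cardinal.lift_aleph0, Cardinal.mul_aleph0_eq hω, Cardinal.add_one_eq hω]
  obtain ⟨e, he⟩ := hs.exists_conj (isShiftPerm_optionShift X) hcard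
  obtain ⟨θ, rfl⟩ := isConj_iff.1 hconj
  refine ⟨X, (θ ∘ Subtype.val) ∘ e.symm, this, (hX.map_mulAut θ).comp_equiv e.symm, fun o => ?_⟩
  obtain ⟨y, rfl⟩ := e.surjective o
  rw [← he]
  simp [hsf]

theorem exists_linearOrder_optionShift (I : Type u) :
    ∃ _ : LinearOrder (Option (I × ℚ)), ∀ q : ℚ, StrictMono (optionShift I q) := by
  classical
  let _ : LinearOrder I := linearOrderOfSTO WellOrderingRel
  -- Lexicographic order with the fixed point at the bottom; translations act only on the second
  -- coordinate.
  let key : Option (I × ℚ) → WithBot (I ×ₗ ℚ) := fun o => o.elim ⊥ fun p => (toLex p : I ×ₗ ℚ)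
  have hkey : Function.Injective key := by
    rintro (_ | p) (_ | q) h
    · rfl
    · exact absurd h.symm (WithBot.coe_ne_bot)
    · exact absurd h (WithBot.coe_ne_bot)
    · have : toLex p = toLex q := WithBot.coe_injective h
      rw [toLex.injective this]
  refine ⟨LinearOrder.lift' key hkey, fun q => ?_⟩
  rintro (_ | ⟨i, a⟩) (_ | ⟨j, b⟩) h
  · exact absurd (show key none < key none from h) (lt_irrefl _)
  · exact WithBot.bot_lt_coe _
  · exact absurd (show key _ < key _ from h) not_lt_bot
  · have h1 : toLex (i, a) < toLex (j, b) := WithBot.coe_lt_coe.1 h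
    have h2 : toLex (i, a + q) < toLex (j, b + q) := by
      rw [Prod.Lex.toLex_lt_toLex] at h1 ⊢
      simpa using h1
    exact WithBot.coe_lt_coe.2 h2

/-- A strictly monotone permutation of a linear order has no nontrivial finite orbits. -/
theorem apply_eq_self_of_zpow_apply_eq_self {Y : Type*} [LinearOrder Y] {s : Equiv.Perm Y}
    (hs : StrictMono s) {y : Y} {k : ℤ} (hk : k ≠ 0) (h : (s ^ k) y = y) : s y = y := by
  have key : ∀ m : ℕ, m ≠ 0 → (s ^ m) y = y → s y = y := by
    intro m hm hy
    rw [Equiv.Perm.coe_pow] at hy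
    rcases lt_trichotomy y (s y) with hlt | heq | hlt
    · have := hs.strictMono_iterate_of_lt_map hlt (Nat.pos_of_ne_zero hm)
      simp only [Function.iterate_zero, id_eq] at this
      exact absurd hy this.ne'
    · exact heq.symm
    · have := hs.strictAnti_iterate_of_map_lt hlt (Nat.pos_of_ne_zero hm)
      simp only [Function.iterate_zero, id_eq] at this
      exact absurd hy this.ne
  obtain ⟨m, rfl | rfl⟩ := k.eq_nat_or_neg
  · exact key m (by simpa using hk) (by simpa using h)
  · refine key m (by simpa using hk) ?_
    rw [zpow_neg, zpow_natCast, Equiv.Perm.inv_eq_iff_eq] at h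
    exact h.symm

end PermutationalAutomorphisms

/-! ### The two implications -/

section MainTheorem

variable {N : Type u} [Group N] {n : ℕ} {πstar π : MulAut N}

theorem exists_conjugation_basis_of_isConj (hstar : IsPiStar (n + 2) πstar)
    (hconj : IsConj πstar π) :
    ∃ X : Set (MulAut N), IsNilpotentBasis (n + 1) (innerAutomorphisms N) X ∧
      ActsWithOneFixedPoint X π ∧
      ∃ _ : LinearOrder X, PreservesOrder X π ∧
        ∀ m : ℕ, 2 ≤ m → ∃ ρ ∈ permutational X, PreservesOrder X ρ ∧ π = ρ ^ m := by
  obtain ⟨I, f, hI, hf, hπ⟩ := exists_rational_coordinates hstar hconj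
  have hg := hf.conj
  have hinj := hg.injective (Nat.le_add_left 1 n)
  set g : Option (I × ℚ) → MulAut N := fun o => MulAut.conj (f o) with hgdef
  obtain ⟨ord, hord⟩ := exists_linearOrder_optionShift I
  let E := Equiv.ofInjective g hinj
  have hperm : ∀ (ρ : MulAut N) (q : ℚ), (∀ o, ρ (f o) = f (optionShift I q o)) →
      ∀ o, MulAut.conj ρ (g o) = g (optionShift I q o) := by
    intro ρ q h o
    rw [hgdef]
    simp only
    rw [← conj_apply_eq, h]
  have hsym : ∀ (ρ : MulAut N) (q : ℚ), (∀ o, ρ (f o) = f (optionShift I q o)) →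
      ρ ∈ permutational (Set.range g) := by
    intro ρ q h
    change MulAut.conj ρ '' Set.range g = Set.range g
    rw [← Set.range_comp]
    have : MulAut.conj ρ ∘ g = g ∘ optionShift I q := funext (hperm ρ q h)
    rw [this, (optionShift I q).surjective.range_comp]
  let ordX : LinearOrder (Set.range g) := LinearOrder.lift' E.symm E.symm.injective
  have hpres : ∀ (ρ : MulAut N) (q : ℚ), (∀ o, ρ (f o) = f (optionShift I q o)) →
      PreservesOrder (Set.range g) ρ := by
    intro ρ q h σ τ σ' τ' hσ hτ hlt
    obtain ⟨a, rfl⟩ := E.surjective σ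
    obtain ⟨b, rfl⟩ := E.surjective τ
    have ha : σ' = E (optionShift I q a) := Subtype.ext (hσ.trans (hperm ρ q h a))
    have hb : τ' = E (optionShift I q b) := Subtype.ext (hτ.trans (hperm ρ q h b))
    have hlt' : a < b := by
      have : E.symm (E a) < E.symm (E b) := hlt
      simpa using this
    rw [ha, hb]
    change E.symm _ < E.symm _
    simpa using hord q hlt'
  have hpow : ∀ (k : ℤ) o, (MulAut.conj π ^ k) (g o) = g ((optionShift I (1 : ℚ) ^ k) o) := by
    intro k
    induction k with
    | zero => exact fun o => rfl
    | succ i ih =>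
      intro o
      rw [zpow_add_one, MulAut.mul_apply, hperm π 1 hπ, ih, zpow_add_one, Equiv.Perm.mul_apply]
    | pred i ih =>
      intro o
      obtain ⟨o, rfl⟩ := (optionShift I (1 : ℚ)).surjective o
      rw [zpow_sub_one, MulAut.mul_apply, ← hperm π 1 hπ, MulAut.inv_apply_self, ih,
        zpow_sub_one, Equiv.Perm.mul_apply, Equiv.Perm.inv_def, Equiv.symm_apply_apply]
  have horb : ∀ o, orbitOf (MulAut.conj π) (g o) =
      g '' Set.range fun k : ℤ => (optionShift I (1 : ℚ) ^ k) o := by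
    intro o
    rw [orbitOf, ← Set.range_comp]
    exact congrArg Set.range (funext fun k => hpow k o)
  have hshift := isShiftPerm_optionShift I
  refine ⟨Set.range g, hg.isNilpotentBasis_range hinj, ⟨hsym π 1 hπ, g none, ⟨none, rfl⟩,
    hperm π 1 hπ none, ?_, ?_⟩, ordX, hpres π 1 hπ, ?_⟩
  · rintro _ ⟨⟨o, rfl⟩, ho⟩ h
    rw [hperm π 1 hπ] at h
    have := hshift.free o (fun h => ho (congrArg g h)) 1 (by simpa using hinj h)
    exact one_ne_zero this
  · refine (hshift.infinite.image (Set.image_injective.2 hinj).injOn).mono ?_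
    rintro _ ⟨_, ⟨o, ho, rfl⟩, rfl⟩
    refine ⟨Set.Infinite.image hinj.injOn (Set.infinite_range_of_injective
      (injective_zpow_apply (hshift.free o ho))), g o, ⟨⟨o, rfl⟩, fun h => ho (hinj h)⟩, ?_⟩
    exact (horb o).symm
  · intro m hm
    -- The root translates the rational coordinate by `1 / m`.
    obtain ⟨ρ, hρ⟩ := hf.exists_mulAut (hf.comp_equiv (optionShift I (1 / m : ℚ)))
    refine ⟨ρ, hsym ρ _ hρ, hpres ρ _ hρ, hf.mulAut_ext fun o => ?_⟩
    have h1 : ∀ (k : ℕ) o, (ρ ^ k) (f o) = f ((optionShift I (1 / m : ℚ) ^ k) o) := by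
      intro k
      induction k with
      | zero => exact fun o => rfl
      | succ k ih =>
        intro o
        rw [pow_succ, MulAut.mul_apply, hρ, Function.comp_apply, ih, pow_succ,
          Equiv.Perm.mul_apply]
    have h2 : m • (1 / m : ℚ) = 1 := by
      rw [nsmul_eq_mul]
      field_simp
    rw [h1, optionShift_pow, h2, hπ]

theorem isConj_of_exists_lift {X : Set (MulAut N)}
    (hX : IsNilpotentFamily (n + 1) (innerAutomorphisms N) (Subtype.val : X → MulAut N))
    (hstar : IsPiStar (n + 2) πstar) {s : Equiv.Perm X} {τ₀ : X} (hs : IsShiftPerm s τ₀)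
    (hπ : ∀ τ : X, MulAut.conj π (τ : MulAut N) = s τ) {x : N}
    (hx : MulAut.conj x = τ₀) (hπx : π x = x) : IsConj πstar π := by
  obtain ⟨Y, t, y₀, hY, ht, hstarY⟩ := hstar.exists_isShiftPerm
  have := ht.infinite_type
  have := hs.infinite_type
  obtain ⟨I, e, -, he, hse⟩ := hs.exists_equiv
  have hinner : ∀ τ : X, ∃ a : N, MulAut.conj a = τ := by
    intro τ
    have : (τ : MulAut N) ∈ innerAutomorphisms N :=
      hX.1 ▸ ⟨FreeGroup.of τ, by simp⟩
    exact this
  choose a ha using hinner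
  -- One preimage is chosen on each infinite orbit and transported by powers of `π`; the fixed
  -- conjugation gets the fixed preimage `x`. Thus `π` permutes these preimages themselves, not only
  -- their images in `Inn N`.
  let f₀ : Option (I × ℤ) → N := fun o => o.elim x fun p => (π ^ p.2) (a (e.symm (some (p.1, 0))))
  have hf₀π : ∀ o, π (f₀ (e o)) = f₀ (e (s o)) := by
    intro o
    obtain ⟨o, rfl⟩ := e.symm.surjective o
    rcases o with _ | ⟨i, k⟩
    · have h1 : e.symm none = τ₀ := by rw [← he, Equiv.symm_apply_apply]
      rw [h1, hs.fixed, he]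
      exact hπx
    · rw [hse, Equiv.apply_symm_apply, Equiv.apply_symm_apply]
      change π ((π ^ k) _) = (π ^ (k + 1)) _
      rw [← MulAut.mul_apply, ← zpow_one_add, add_comm]
  have hstep : ∀ τ : X, MulAut.conj (f₀ (e τ)) = τ ↔ MulAut.conj (f₀ (e (s τ))) = s τ := by
    intro τ
    rw [← hf₀π, conj_apply_eq, ← hπ]
    exact (MulAut.conj π).injective.eq_iff.symm
  have hf₀ : ∀ τ : X, MulAut.conj (f₀ (e τ)) = τ := by
    intro τ
    obtain ⟨o, rfl⟩ := e.symm.surjective τ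
    rcases o with _ | ⟨i, k⟩
    · have h1 : e.symm none = τ₀ := by rw [← he, Equiv.symm_apply_apply]
      rw [h1, he]
      exact hx
    · induction k with
      | zero =>
        rw [Equiv.apply_symm_apply]
        exact ha _
      | succ k ih => rw [← hse, ← hstep, ih]
      | pred k ih => rw [hstep, hse, sub_add_cancel, ih]
  have hf : IsNilpotentFamily (n + 2) (⊤ : Subgroup N) fun τ : X => f₀ (e τ) := by
    refine IsNilpotentFamily.of_conj (Nat.le_add_left 1 n) hY ?_
    simpa only [hf₀] using hX
  have hcard : Cardinal.mk Y = Cardinal.mk X :=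
    -- Every infinite basis has the cardinality of the group.
    (hY.mk_eq (Nat.le_add_left 1 (n + 1))).trans (hf.mk_eq (Nat.le_add_left 1 (n + 1))).symm
  obtain ⟨b, hb⟩ := ht.exists_conj hs hcard
  obtain ⟨θ, hθ⟩ := hY.exists_mulAut (hf.comp_equiv b)
  refine isConj_iff.2 ⟨θ, ?_⟩
  rw [mul_inv_eq_iff_eq_mul]
  refine hY.mulAut_ext fun y => ?_
  rw [MulAut.mul_apply, MulAut.mul_apply, hstarY, hθ, hθ, Function.comp_apply, Function.comp_apply,
    hb, hf₀π]

theorem isConj_of_exists_conjugation_basis (hstar : IsPiStar (n + 2) πstar)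
    {X : Set (MulAut N)} (hX : IsNilpotentBasis (n + 1) (innerAutomorphisms N) X)
    (hact : ActsWithOneFixedPoint X π) [LinearOrder X] (hord : PreservesOrder X π)
    (hroot : ∀ m : ℕ, 2 ≤ m → ∃ ρ ∈ permutational X, PreservesOrder X ρ ∧ π = ρ ^ m) :
    IsConj πstar π := by
  obtain ⟨hπX, τ₀, hτ₀, hfix, hne, hinf⟩ := hact
  have hmono : StrictMono (imagePerm (MulAut.conj π) hπX) :=
    fun σ τ h => hord σ τ _ _ rfl rfl h
  have hs : IsShiftPerm (imagePerm (MulAut.conj π) hπX) ⟨τ₀, hτ₀⟩ := by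
    refine isShiftPerm_imagePerm hπX hfix ?_ hinf fun O hO => hO.2
    intro τ hτ k hk
    by_contra hk0
    rw [← coe_imagePerm_zpow _ hπX] at hk
    exact hne τ ⟨τ.2, fun h => hτ (Subtype.ext h)⟩
      -- The invariant order excludes the finite orbits that the first condition leaves open.
      (congrArg Subtype.val (apply_eq_self_of_zpow_apply_eq_self hmono hk0 (Subtype.ext hk)))
  have := hs.infinite_type
  have hinner : ∀ τ : X, ∃ a : N, MulAut.conj a = τ := by
    intro τ
    have : (τ : MulAut N) ∈ innerAutomorphisms N :=
      hX.1 ▸ ⟨FreeGroup.of τ, by simp⟩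
    exact this
  choose a ha using hinner
  have haX : IsNilpotentFamily (n + 2) (⊤ : Subgroup N) a := by
    obtain ⟨Y, t, y₀, hY, ht, -⟩ := hstar.exists_isShiftPerm
    have := ht.infinite_type
    refine IsNilpotentFamily.of_conj (Nat.le_add_left 1 n) hY ?_
    rw [funext ha]
    exact hX
  have hconj : ∀ (ρ : MulAut N) (hρ : ρ ∈ permutational X) (τ : X),
      MulAut.conj (ρ (a τ)) = MulAut.conj (a (imagePerm (MulAut.conj ρ) hρ τ)) := by
    intro ρ hρ τ
    rw [conj_apply_eq, ha, ha]
    rfl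
  obtain ⟨x, hx, hπx⟩ := exists_fixed_lift haX (hconj π hπX) hs.fixed hs.free fun m hm => by
    obtain ⟨ρ, hρ, -, hρm⟩ := hroot m hm
    have hpow : imagePerm (MulAut.conj ρ) hρ ^ m = imagePerm (MulAut.conj π) hπX := by
      ext1 τ
      apply Subtype.ext
      have := coe_imagePerm_zpow (MulAut.conj ρ) hρ m τ
      rw [zpow_natCast, zpow_natCast] at this
      rw [this, ← map_pow, ← hρm]
      rfl
    refine ⟨ρ, imagePerm (MulAut.conj ρ) hρ, hconj ρ hρ, hρm.symm, hpow, ?_⟩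
    -- The root commutes with `π`, so it maps `τ₀` to a fixed point of `π`, and `τ₀` is the only one
    -- in `X`.
    by_contra hr
    refine one_ne_zero (hs.free _ hr 1 ?_)
    rw [zpow_one]
    conv_rhs => rw [← hs.fixed]
    rw [← hpow, ← Equiv.Perm.mul_apply, ← Equiv.Perm.mul_apply, ← pow_succ, ← pow_succ']
  exact isConj_of_exists_lift hX hstar hs (fun τ => rfl) (hx.trans (ha _)) hπx

end MainTheorem

theorem mainTheorem5 {N : Type*} [Group N] (c : ℕ) (hc : 2 ≤ c)
    (hN : IsFreeNilpotent c N) (hinf : ¬ Group.FG N)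
    (πstar : MulAut N) (hstar : IsPiStar c πstar) (π : MulAut N) :
    IsConj πstar π ↔
      ∃ X : Set (MulAut N), IsNilpotentBasis (c - 1) (innerAutomorphisms N) X ∧
        ActsWithOneFixedPoint X π ∧
        ∃ _ : LinearOrder X, PreservesOrder X π ∧
          ∀ n : ℕ, 2 ≤ n → ∃ ρ ∈ permutational X, PreservesOrder X ρ ∧ π = ρ ^ n := by
  obtain ⟨n, rfl⟩ := Nat.exists_eq_add_of_le' hc
  constructor
  · exact exists_conjugation_basis_of_isConj hstar
  · rintro ⟨X, hX, hact, hlin, hord, hroot⟩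
    exact isConj_of_exists_conjugation_basis hstar hX hact hord hroot
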